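/- **Setting.** Let $\mathcal T$ be a finite rooted tree; its leaves are the vertices without children. *Tree polynomial:* for a leaf $w$ put $p[w](x)=x$; for a vertex $w$ with children $w_1,\dots,w_r$, $r\ge 1$, put $p[w](x)=x\bigl(1-\prod_{i=1}^r(1-p[w_i](x))\bigr)$; and let $p[\mathcal T]=p[\mathrm{root}]\in\mathbb Z[x]$. *Cutting procedure:* start with $G_0=\mathcal T$; given a non-empty $G_i$, remove a uniformly random vertex of $G_i$ (independently of the past) and keep only the connected component containing the root (nothing, if the root has been removed), which gives $G_{i+1}$; stop when the graph is empty. Let $\mathfrak S=\inf\{i\ge 0: G_i \text{ contains no leaf of }\mathcal T\}$, let $\mathcal T_{\mathfrak S}=G_{\mathfrak S}$, and let $|\mathcal T_{\mathfrak S}|$ be its number of vertices. For $n\ge 1$ let $\mathcal T_n$ be the complete binary tree on $n$ vertices: with $m=\lfloor\log_2 n\rfloor$, it has all $2^k$ possible vertices at height $k$ for $0\le k<m$, and its remaining $n-2^m+1$ vertices are in the left-most positions at height $m$. Let $\mathrm{CBT}_n$ be the full complete binary tree, with $2^h$ vertices at every height $h=0,\dots,n-1$. Let $\varphi(x)=\max\{0,\,2-\tfrac1x\}$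 for $x\in(0,1]$ and $\varphi(0)=0$. **Proposition 6.4.** As $n\to\infty$, $p[\mathcal T_n]\to\varphi$ uniformly on $[0,1]$. Moreover, the numbers $$P(m)=\binom{2m}{m}\int_0^1 x^{m-1}(1-x)^m\varphi(x)\,dx,\qquad m=0,1,2,\dots,$$ are the masses of a probability distribution on $\{0,1,2,\dots\}$; $|\mathcal T_{n,\mathfrak S}|$ and $|\mathrm{CBT}_{n,\mathfrak S}|$ both converge in distribution to this law as $n\to\infty$; and this law has infinite mean. -/

import Mathlib

open Filter Topology MeasureTheory Polynomial

noncomputable section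

namespace TreeCut

/-! ## The cutting procedure on a finite graph with sources and targets

Induced subgraphs of `G` are represented by their vertex sets `A : Finset V`. -/

open Classical in
/-- The vertices of those connected components of the induced subgraph `G[B]` that contain
a source: `v` is kept iff some walk of `G` that stays inside `B` joins a source to `v`. -/
def keepSources {V : Type} [Fintype V] (G : SimpleGraph V) (S B : Finset V) : Finset V :=
  Finset.univ.filter fun v => ∃ s ∈ S, ∃ p : G.Walk s v, ∀ u ∈ p.support, u ∈ B

theorem keepSources_subset {V : Type} [Fintype V] (G : SimpleGraph V) (S B : Finset V) : keepSources G S B ⊆ B := by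
  intro v hv
  simp only [keepSources, Finset.mem_filter, Finset.mem_univ, true_and] at hv
  obtain ⟨s, _, p, hp⟩ := hv
  exact hp v p.end_mem_support

theorem card_keepSources_erase_lt {V : Type} [Fintype V] [DecidableEq V] (G : SimpleGraph V)
    (S A : Finset V) (v : {v // v ∈ A}) :
    (keepSources G S (A.erase v.1)).card < A.card :=
  (Finset.card_le_card (keepSources_subset G S _)).trans_lt (Finset.card_erase_lt_of_mem v.2)

/-- The law of the cutting procedure started from the induced subgraph on `A`, as a probability
mass function on finite sequences `[G₀, G₁, …, G_r]` with `G₀ = A` and `G_r = ∅`: as long as the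
current graph is non-empty, a uniformly random vertex `v` of it is removed, only the components
that contain a source are kept, and the procedure continues (with fresh randomness) from there. -/
def cutLaw {V : Type} [Fintype V] [DecidableEq V] (G : SimpleGraph V) (S A : Finset V) : PMF (List (Finset V)) :=
  if h : A.Nonempty then
    haveI : Nonempty {v // v ∈ A} := h.to_subtype
    (PMF.uniformOfFintype {v // v ∈ A}).bind fun v =>
      (cutLaw G S (keepSources G S (A.erase v.1))).map fun l => A :: l
  else PMF.pure [∅]
termination_by A.card
decreasing_by exact card_keepSources_erase_lt G S A v

/-- The separation number of a realisation `l = [G₀, …, G_r]` of the cutting procedure: the first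
index `i` such that `G_i` contains no target. -/
def separationNumber {V : Type} [DecidableEq V] (T : Finset V) (l : List (Finset V)) : ℕ :=
  l.findIdx fun A => decide (Disjoint A T)

/-- The separation subgraph: the graph present at the time of separation. -/
def separationGraph {V : Type} [DecidableEq V] (T : Finset V) (l : List (Finset V)) : Finset V :=
  l.getD (separationNumber T l) ∅

/-- The law of the number of vertices of the separation subgraph of `G` with sources `S` and
targets `T`, where the cutting procedure starts from the whole graph. -/
def separationSizeLaw {V : Type} [Fintype V] [DecidableEq V] (G : SimpleGraph V)
    (S T : Finset V) : ProbabilityMeasure ℕ :=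
  ⟨((cutLaw G S Finset.univ).map fun l => (separationGraph T l).card).toMeasure, inferInstance⟩

/-! ## Rooted trees

A rooted tree is a tree `G` together with a vertex `r`, its root. -/

open Classical in
/-- The children of `w`: the neighbours of `w` that are farther away from the root. -/
def children {V : Type} [Fintype V] (G : SimpleGraph V) (r w : V) : Finset V :=
  Finset.univ.filter fun v => G.Adj w v ∧ G.dist r v = G.dist r w + 1

open Classical in
/-- The leaves of a rooted tree: the vertices without children. -/
def leaves {V : Type} [Fintype V] (G : SimpleGraph V) (r : V) : Finset V :=
  Finset.univ.filter fun w => children G r w = ∅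

theorem card_sub_dist_lt {V : Type} [Fintype V] (G : SimpleGraph V) (r w : V) (v : {v // v ∈ children G r w}) :
    Fintype.card V - G.dist r v.1 < Fintype.card V - G.dist r w := by
  have hv : G.Adj w v.1 ∧ G.dist r v.1 = G.dist r w + 1 := by
    simpa [children] using v.2
  have hr : G.Reachable r v.1 := by
    by_contra h
    have := SimpleGraph.dist_eq_zero_of_not_reachable h
    omega
  obtain ⟨p, hp, hlen⟩ := hr.exists_path_of_dist
  have := hp.length_lt
  omega

open Classical in
/-- The polynomial `p[w]` attached to the vertex `w` of the rooted tree `(G, r)`: it is `x` if `w`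
is a leaf, and `x (1 - ∏ᵢ (1 - p[wᵢ]))` if `w` has the children `w₁, …, w_k`, `k ≥ 1`. -/
def vertexPoly {V : Type} [Fintype V] (G : SimpleGraph V) (r w : V) : ℤ[X] :=
  if children G r w = ∅ then X
  else X * (1 - ∏ v : {v // v ∈ children G r w}, (1 - vertexPoly G r v.1))
termination_by Fintype.card V - G.dist r w
decreasing_by exact card_sub_dist_lt G r w v

/-- The polynomial of the rooted tree `(G, r)` is the one of its root. -/
def treePoly {V : Type} [Fintype V] (G : SimpleGraph V) (r : V) : ℤ[X] := vertexPoly G r r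

/-- The law of the size of the separation subgraph of a rooted tree: the root is the only source,
and the targets are the leaves. -/
def treeSeparationSizeLaw {V : Type} [Fintype V] [DecidableEq V] (G : SimpleGraph V) (r : V) :
    ProbabilityMeasure ℕ :=
  separationSizeLaw G {r} (leaves G r)

/-! ## Binary trees -/

/-- The complete binary tree on `n` vertices, whose vertices `0, …, n - 1` are numbered level by
level and from left to right: `2 ^ h - 1 + j` with `j < 2 ^ h` is the `j`-th vertex at height `h`,
and the children of `i` are those of `2 i + 1` and `2 i + 2` that are less than `n`. Its root
is `0`. -/
def completeBinaryTree (n : ℕ) : SimpleGraph (Fin n) :=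
  SimpleGraph.fromRel fun i j => j.val = 2 * i.val + 1 ∨ j.val = 2 * i.val + 2

/-- The vertices of the full complete binary tree with `n` levels: for each height `h < n` there
are `2 ^ h` of them. -/
abbrev FullVertex (n : ℕ) : Type := Σ h : Fin n, Fin (2 ^ h.val)

/-- The full complete binary tree with `n` levels: the `j`-th vertex at height `h` is joined to
the vertices `2 j` and `2 j + 1` at height `h + 1`. -/
def fullBinaryTree (n : ℕ) : SimpleGraph (FullVertex n) :=
  SimpleGraph.fromRel fun u v =>
    v.1.val = u.1.val + 1 ∧ (v.2.val = 2 * u.2.val ∨ v.2.val = 2 * u.2.val + 1)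

/-- The root of the full complete binary tree with `n + 1` levels. -/
def fullRoot (n : ℕ) : FullVertex (n + 1) := ⟨0, ⟨0, by simp⟩⟩

/-! ## The limit -/

/-- `φ(x) = max {0, 2 - 1 / x}`, which is `0` at `x = 0` (where `1 / x = +∞`). -/
def phi (x : ℝ) : ℝ := if x = 0 then 0 else max 0 (2 - 1 / x)

/-- `C(2m, m) ∫₀¹ x ^ (m - 1) (1 - x) ^ m φ(x) dx`. -/
def limitMass (m : ℕ) : ℝ :=
  ((2 * m).choose m : ℝ) * ∫ x in (0 : ℝ)..1, x ^ ((m : ℤ) - 1) * (1 - x) ^ m * phi x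

end TreeCut

end

/-!
# Cutting down complete binary trees

Retain every vertex of a graph with probability `x`, independently of the others, and let `x`
decrease from `1` to `0`. The vertices disappear in a uniformly random order, and the order in which
those of the current component of the sources disappear is the cutting procedure. At the time of
separation, a *pivotal* vertex is removed: before its removal a target is connected to a source, and
afterwards none is. Hence the separation graph has size `m` with probability
`∫₀¹ x⁻¹ E[N] dx`, where `N` is the number of retained pivotal vertices whose removal leaves a
component of size `m`. This is `separationSizeLaw_real_singleton`; it is proved without a coupling,
by the fact that both sides satisfy the same recursion (`sizeLaw_keepSources` and `pivotSum_rec`).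

Both families of trees consist of binary heaps `{0, …, n - 1}`, in which `i` has the children
`2 i + 1` and `2 i + 2`; the full tree with `n` levels is the heap with `2 ^ n - 1` vertices. In a
heap, the independence of the two subtrees of a vertex gives recursions for the generating function
`cutGF` of the size of the component of `i` on the event that `i` is cut off from the leaves, and for
the generating function `pivotGF` of the pivotal vertices (`cutGF_of_lt`, `pivotGF_of_lt`). The tree
polynomial is `1 - cutGF` at `z = 1`.

For the full tree of height `k`, the tree polynomials are the iterates of
`p ↦ x (1 - (1 - p) ^ 2)`, whose distance `e` to the fixed point `φ(x)` becomes at most `e (1 - e / 2)`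
in each step, so that it is at most `2 / (k + 2)`. In a heap of height `k`, one of the two subtrees
of the root is full, and the recursion halves the error of the other one because
`x (1 - φ(x)) ≤ 1 / 2`; this gives the bound `12 / (k + 1)` (`abs_complete_sub_le`), and hence uniform
convergence. The recursions for the coefficients of the generating functions then pass to the limit,
where they are solved by the Catalan numbers and the central binomial coefficients
(`tendsto_coeff_cutGF`, `tendsto_coeff_pivotGF`), and dominated convergence gives the limits of the
masses.

The limits add up to one because the central binomial coefficients have the generating function
`1 / (2 x - 1)` at `x (1 - x)` for `x > 1 / 2`, which leaves the integral of `1 / x ^ 2` over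
`[1 / 2, 1]`. Therefore no mass escapes and the convergence is weak. The mass at `m` is at least
`1 / (8 m (m + 1))`, so that the mean is infinite.
-/

noncomputable section

namespace TreeCut

/-! ### The cutting procedure on a graph and random retained sets -/

theorem separationGraph_cons_of_disjoint {V : Type} [DecidableEq V] {T A : Finset V}
    (h : Disjoint A T) (l : List (Finset V)) : separationGraph T (A :: l) = A := by
  simp [separationGraph, separationNumber, List.findIdx_cons, h]

theorem separationGraph_cons_of_not_disjoint {V : Type} [DecidableEq V] {T A : Finset V}
    (h : ¬ Disjoint A T) (l : List (Finset V)) : separationGraph T (A :: l) = separationGraph T l := by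
  simp [separationGraph, separationNumber, List.findIdx_cons, h]

section Cutting

variable {V : Type} [Fintype V]

theorem mem_keepSources {G : SimpleGraph V} {S B : Finset V} {v : V} :
    v ∈ keepSources G S B ↔ ∃ s ∈ S, ∃ p : G.Walk s v, ∀ u ∈ p.support, u ∈ B := by
  simp [keepSources]

theorem keepSources_mono (G : SimpleGraph V) (S : Finset V) {A B : Finset V} (h : A ⊆ B) :
    keepSources G S A ⊆ keepSources G S B := by
  intro v hv
  rw [mem_keepSources] at hv ⊢
  obtain ⟨s, hs, p, hp⟩ := hv
  exact ⟨s, hs, p, fun u hu => h (hp u hu)⟩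

/-- Pruning depends only on the pruned set: every set between `keepSources G S A` and `A` has the
same components that contain a source. -/
theorem keepSources_congr {G : SimpleGraph V} {S A B : Finset V}
    (h₁ : keepSources G S A ⊆ B) (h₂ : B ⊆ A) : keepSources G S B = keepSources G S A := by
  classical
  refine (keepSources_mono G S h₂).antisymm fun v hv => ?_
  rw [mem_keepSources] at hv ⊢
  obtain ⟨s, hs, p, hp⟩ := hv
  refine ⟨s, hs, p, fun _ hu => h₁ (mem_keepSources.2 ⟨s, hs, p.takeUntil _ hu, fun w hw => ?_⟩)⟩
  exact hp w (p.support_takeUntil_subset_support hu hw)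

variable [DecidableEq V]

theorem keepSources_erase_of_notMem {G : SimpleGraph V} {S A : Finset V} {v : V}
    (hv : v ∉ keepSources G S A) : keepSources G S (A.erase v) = keepSources G S A :=
  keepSources_congr (fun _ hu => Finset.mem_erase.2
    ⟨fun h => hv (h ▸ hu), keepSources_subset G S A hu⟩) (Finset.erase_subset _ _)

theorem keepSources_keepSources_erase (G : SimpleGraph V) (S A : Finset V) (v : V) :
    keepSources G S ((keepSources G S A).erase v) = keepSources G S (A.erase v) := by
  refine keepSources_congr (fun _ hu => Finset.mem_erase.2 ⟨?_, ?_⟩)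
    (Finset.erase_subset_erase _ (keepSources_subset G S A))
  · exact (Finset.mem_erase.1 (keepSources_subset G S _ hu)).1
  · exact keepSources_mono G S (Finset.erase_subset _ _) hu

/-- The law of the size of the separation graph when the procedure starts from `A`. -/
def sizeLaw (G : SimpleGraph V) (S T A : Finset V) : PMF ℕ :=
  (cutLaw G S A).map fun l => (separationGraph T l).card

theorem sizeLaw_of_disjoint (G : SimpleGraph V) (S : Finset V) {T A : Finset V}
    (h : Disjoint A T) : sizeLaw G S T A = PMF.pure A.card := by
  rw [sizeLaw, cutLaw]
  split_ifs with hA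
  · rw [PMF.map_bind]
    simp only [PMF.map_comp, Function.comp_def, separationGraph_cons_of_disjoint h]
    exact (congrArg _ (funext fun v => PMF.map_const _ _)).trans (PMF.bind_const _ _)
  · rw [Finset.not_nonempty_iff_eq_empty] at hA
    subst hA
    rw [PMF.pure_map, separationGraph_cons_of_disjoint h]

theorem sizeLaw_of_not_disjoint (G : SimpleGraph V) (S : Finset V) {T A : Finset V}
    (h : ¬ Disjoint A T) (m : ℕ) :
    (A.card : ℝ) * (sizeLaw G S T A m).toReal =
      ∑ v ∈ A, (sizeLaw G S T (keepSources G S (A.erase v)) m).toReal := by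
  have hA : A.Nonempty := by
    rw [Finset.nonempty_iff_ne_empty]
    rintro rfl
    exact h (Finset.disjoint_empty_left _)
  have key : sizeLaw G S T A m = ∑ v ∈ A, (A.card : ENNReal)⁻¹ *
      sizeLaw G S T (keepSources G S (A.erase v)) m := by
    rw [sizeLaw, cutLaw, dif_pos hA, PMF.map_bind]
    simp only [PMF.map_comp, Function.comp_def, separationGraph_cons_of_not_disjoint h]
    rw [PMF.bind_apply, tsum_fintype, ← Finset.sum_coe_sort A]
    simp [sizeLaw]
  have hc : (A.card : ℝ) ≠ 0 := by exact_mod_cast hA.card_pos.ne'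
  rw [key, ENNReal.toReal_sum, Finset.mul_sum]
  · refine Finset.sum_congr rfl fun v _ => ?_
    rw [ENNReal.toReal_mul, ENNReal.toReal_inv, ENNReal.toReal_natCast]
    field_simp
  · intro v _
    exact ENNReal.mul_ne_top (by simp [hA.card_pos.ne']) (PMF.apply_ne_top _ _)

/-- Pruning away the vertices that are not connected to a source does not change the law. -/
theorem sizeLaw_keepSources (G : SimpleGraph V) (S : Finset V) {T A : Finset V}
    (h : ¬ Disjoint (keepSources G S A) T) (m : ℕ) :
    (A.card : ℝ) * (sizeLaw G S T (keepSources G S A) m).toReal =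
      ∑ v ∈ A, (sizeLaw G S T (keepSources G S (A.erase v)) m).toReal := by
  have h1 := sizeLaw_of_not_disjoint G S h m
  have hsub := keepSources_subset G S A
  simp only [keepSources_keepSources_erase] at h1
  rw [← Finset.sum_sdiff hsub, ← h1, Finset.sum_congr rfl (g := fun _ =>
    (sizeLaw G S T (keepSources G S A) m).toReal), Finset.sum_const, nsmul_eq_mul,
    Finset.card_sdiff_of_subset hsub, Nat.cast_sub (Finset.card_le_card hsub)]
  · ring
  · intro v hv
    rw [keepSources_erase_of_notMem (Finset.mem_sdiff.1 hv).2]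

open Classical in
/-- The number of vertices `v ∈ W` that are pivotal for `W`, with a residual graph of size `m`:
a target is connected to a source in `W`, but not in `W \ {v}`, where the sources have a component
of size `m`. -/
def pivotCount (G : SimpleGraph V) (S T : Finset V) (m : ℕ) (W : Finset V) : ℕ :=
  (W.filter fun v => ¬ Disjoint (keepSources G S W) T ∧
    Disjoint (keepSources G S (W.erase v)) T ∧ (keepSources G S (W.erase v)).card = m).card

/-- `∫₀¹ x ^ (w - 1) (1 - x) ^ k dx`, a value of the Beta function for `w ≥ 1`. -/
def betaInt (w k : ℕ) : ℝ := ∫ x in (0 : ℝ)..1, x ^ (w - 1) * (1 - x) ^ k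

theorem betaInt_zero {w : ℕ} (hw : 0 < w) : w * betaInt w 0 = 1 := by
  obtain ⟨w, rfl⟩ := Nat.exists_eq_succ_of_ne_zero hw.ne'
  have : (w : ℝ) + 1 ≠ 0 := by positivity
  simp [betaInt, integral_pow]
  field_simp

/-- Integration of the derivative of `x ^ w * (1 - x) ^ (k + 1)`. -/
theorem betaInt_succ {w : ℕ} (hw : 0 < w) (k : ℕ) :
    ((w + k + 1 : ℕ) : ℝ) * betaInt w (k + 1) = (k + 1 : ℕ) * betaInt w k := by
  obtain ⟨w, rfl⟩ := Nat.exists_eq_succ_of_ne_zero hw.ne'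
  have hd : ∀ x ∈ Set.uIcc (0 : ℝ) 1, HasDerivAt (fun x : ℝ => x ^ (w + 1) * (1 - x) ^ (k + 1))
      (((w + 1 + k + 1 : ℕ) : ℝ) * (x ^ w * (1 - x) ^ (k + 1)) -
        (k + 1 : ℕ) * (x ^ w * (1 - x) ^ k)) x := by
    intro x _
    have h1 := hasDerivAt_pow (w + 1) x
    have h2 := ((hasDerivAt_id x).const_sub 1).pow (k + 1)
    refine (h1.mul h2).congr_deriv ?_
    simp only [id, Pi.pow_apply, Nat.add_sub_cancel]
    push_cast
    ring
  have := intervalIntegral.integral_eq_sub_of_hasDerivAt hd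
    (Continuous.intervalIntegrable (by fun_prop) _ _)
  rw [intervalIntegral.integral_sub (Continuous.intervalIntegrable (by fun_prop) _ _)
    (Continuous.intervalIntegrable (by fun_prop) _ _), intervalIntegral.integral_const_mul,
    intervalIntegral.integral_const_mul] at this
  simp only [betaInt, Nat.succ_eq_add_one, Nat.add_sub_cancel]
  simp only [sub_self, ne_eq, Nat.add_eq_zero_iff, one_ne_zero, and_false, not_false_eq_true,
    zero_pow, mul_zero, zero_mul] at this
  linarith

theorem pivotCount_empty (G : SimpleGraph V) (S T : Finset V) (m : ℕ) :
    pivotCount G S T m ∅ = 0 := by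
  simp [pivotCount]

theorem pivotCount_eq_zero {G : SimpleGraph V} {S T W : Finset V} (m : ℕ)
    (h : Disjoint (keepSources G S W) T) : pivotCount G S T m W = 0 := by
  simp [pivotCount, h]

/-- The sum over `W ⊆ A` of the pivot counts, weighted by the probability that a uniformly random
ordering of `A` ends with the elements of `W`, the first of them being the pivotal vertex. -/
def pivotSum (G : SimpleGraph V) (S T : Finset V) (m : ℕ) (A : Finset V) : ℝ :=
  ∑ W ∈ A.powerset, betaInt W.card (A.card - W.card) * pivotCount G S T m W

/-- The recursion of the cutting procedure without pruning, in which every vertex of `A`, connected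
to a source or not, is the first one to be removed with the same probability. -/
theorem pivotSum_rec (G : SimpleGraph V) (S T : Finset V) (m : ℕ) (A : Finset V) :
    (A.card : ℝ) * pivotSum G S T m A =
      pivotCount G S T m A + ∑ v ∈ A, pivotSum G S T m (A.erase v) := by
  have hswap : ∑ v ∈ A, pivotSum G S T m (A.erase v) =
      ∑ W ∈ A.powerset, ∑ v ∈ A \ W,
        betaInt W.card (A.card - 1 - W.card) * pivotCount G S T m W := by
    unfold pivotSum
    rw [Finset.sum_comm' (t' := A.powerset) (s' := fun W => A \ W)]
    · refine Finset.sum_congr rfl fun W _ => Finset.sum_congr rfl fun v hv => ?_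
      rw [Finset.card_erase_of_mem (Finset.mem_sdiff.1 hv).1]
    · intro v W
      simp only [Finset.mem_powerset, Finset.mem_sdiff, Finset.subset_erase]
      tauto
  rw [hswap, pivotSum, Finset.mul_sum, ← Finset.add_sum_erase _ _ (Finset.mem_powerset_self A),
    ← Finset.add_sum_erase _ (fun W => ∑ v ∈ A \ W, _) (Finset.mem_powerset_self A)]
  simp only [sdiff_self, Finset.bot_eq_empty, Finset.sum_empty, zero_add]
  congr 1
  · rcases A.eq_empty_or_nonempty with rfl | hA
    · simp [pivotCount_empty]
    · rw [← mul_assoc, Nat.sub_self, betaInt_zero hA.card_pos, one_mul]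
  · refine Finset.sum_congr rfl fun W hW => ?_
    rw [Finset.mem_erase, Finset.mem_powerset] at hW
    rw [Finset.sum_const, nsmul_eq_mul, Finset.card_sdiff_of_subset hW.2]
    rcases W.eq_empty_or_nonempty with rfl | hW0
    · simp [pivotCount_empty]
    have hlt := Finset.card_lt_card (hW.2.ssubset_of_ne hW.1)
    obtain ⟨k, hk⟩ := Nat.exists_eq_add_of_lt hlt
    have h1 : A.card - W.card = k + 1 := by omega
    have h2 : A.card - 1 - W.card = k := by omega
    rw [h1, h2, hk, ← mul_assoc, ← mul_assoc, betaInt_succ hW0.card_pos]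

open Classical in
/-- Unless no target is connected to a source to begin with, the mass at `m` is `pivotSum`: both sides
satisfy the same recursion in `A`, since the removal of a vertex outside the kept components
changes nothing. -/
theorem sizeLaw_eq_pivotSum (G : SimpleGraph V) (S T : Finset V) (m : ℕ) (A : Finset V) :
    (sizeLaw G S T (keepSources G S A) m).toReal =
      (if Disjoint (keepSources G S A) T ∧ (keepSources G S A).card = m then 1 else 0) +
        pivotSum G S T m A := by
  induction A using Finset.strongInduction with
  | H A ih =>
  by_cases h : Disjoint (keepSources G S A) T
  · have h0 : pivotSum G S T m A = 0 := by
      refine Finset.sum_eq_zero fun W hW => ?_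
      rw [pivotCount_eq_zero m (h.mono_left (keepSources_mono G S (Finset.mem_powerset.1 hW)))]
      simp
    rw [sizeLaw_of_disjoint G S h, h0, PMF.pure_apply]
    simp only [h, true_and, add_zero, eq_comm (a := m)]
    split_ifs <;> simp
  · have hA : (A.card : ℝ) ≠ 0 := by
      rw [Nat.cast_ne_zero, Finset.card_ne_zero, Finset.nonempty_iff_ne_empty]
      rintro rfl
      refine h ?_
      rw [Finset.subset_empty.1 (keepSources_subset G S ∅)]
      exact Finset.disjoint_empty_left _
    refine mul_left_cancel₀ hA ?_
    rw [sizeLaw_keepSources G S h, if_neg (fun hh => h hh.1), zero_add, pivotSum_rec,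
      Finset.sum_congr rfl fun v hv => ih _ (Finset.erase_ssubset hv), Finset.sum_add_distrib]
    congr 1
    rw [pivotCount, Finset.card_filter]
    push_cast
    refine Finset.sum_congr rfl fun v _ => ?_
    simp [h]

/-- The mass at `m` of the law of the size of the separation graph, as an integral over the
probability `x` with which the vertices are retained independently of each other. -/
theorem separationSizeLaw_real_singleton (G : SimpleGraph V) (S T : Finset V) (m : ℕ)
    (hS : keepSources G S Finset.univ = Finset.univ) (hT : T.Nonempty) :
    ((separationSizeLaw G S T : ProbabilityMeasure ℕ) : Measure ℕ).real {m} =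
      ∫ x in (0 : ℝ)..1, x⁻¹ * ∑ W : Finset V, x ^ W.card * (1 - x) ^ (Fintype.card V - W.card) *
        pivotCount G S T m W := by
  classical
  have h1 : ((separationSizeLaw G S T : ProbabilityMeasure ℕ) : Measure ℕ).real {m} =
      (sizeLaw G S T Finset.univ m).toReal := by
    rw [Measure.real]
    congr 1
    exact PMF.toMeasure_apply_singleton _ _ (measurableSet_singleton m)
  have h2 := sizeLaw_eq_pivotSum G S T m Finset.univ
  rw [hS, if_neg, zero_add] at h2
  · rw [h1, h2, pivotSum, Finset.powerset_univ]
    simp only [betaInt, ← intervalIntegral.integral_mul_const]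
    rw [← intervalIntegral.integral_finsetSum
      fun W _ => Continuous.intervalIntegrable (by fun_prop) _ _]
    refine intervalIntegral.integral_congr_ae (.of_forall fun x hx => ?_)
    rw [Set.uIoc_of_le zero_le_one] at hx
    have hx0 : x ≠ 0 := hx.1.ne'
    rw [Finset.mul_sum]
    refine Finset.sum_congr rfl fun W _ => ?_
    rcases W.eq_empty_or_nonempty with rfl | hW
    · simp [pivotCount_empty]
    · obtain ⟨w, hw⟩ := Nat.exists_eq_succ_of_ne_zero hW.card_pos.ne'
      rw [hw, Finset.card_univ, Nat.succ_eq_add_one, Nat.add_sub_cancel, pow_succ]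
      field_simp
  · rintro ⟨h, -⟩
    obtain ⟨t, ht⟩ := hT
    exact Finset.disjoint_left.1 h (Finset.mem_univ t) ht

end Cutting

/-! ### Random subsets -/

section WeightedSum

variable {R : Type*} [CommRing R]

/-- The expectation of `f W`, where `W` is the random subset of `S` that retains every element
with probability `x` independently of the others, in an arbitrary commutative ring. -/
def subsetSum (x : R) (S : Finset ℕ) (f : Finset ℕ → R) : R :=
  ∑ W ∈ S.powerset, x ^ W.card * (1 - x) ^ (S.card - W.card) * f W

theorem subsetSum_congr {x : R} {S : Finset ℕ} {f g : Finset ℕ → R} (h : ∀ W ⊆ S, f W = g W) :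
    subsetSum x S f = subsetSum x S g :=
  Finset.sum_congr rfl fun W hW => by rw [h W (Finset.mem_powerset.1 hW)]

theorem subsetSum_add (x : R) (S : Finset ℕ) (f g : Finset ℕ → R) :
    subsetSum x S (fun W => f W + g W) = subsetSum x S f + subsetSum x S g := by
  simp only [subsetSum, mul_add, Finset.sum_add_distrib]

theorem subsetSum_const_mul (x : R) (S : Finset ℕ) (c : R) (f : Finset ℕ → R) :
    subsetSum x S (fun W => c * f W) = c * subsetSum x S f := by
  simp only [subsetSum, Finset.mul_sum]
  exact Finset.sum_congr rfl fun W _ => by ring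

theorem subsetSum_mul_const (x : R) (S : Finset ℕ) (c : R) (f : Finset ℕ → R) :
    subsetSum x S (fun W => f W * c) = subsetSum x S f * c := by
  simp only [mul_comm _ c, subsetSum_const_mul]

theorem subsetSum_empty (x : R) (f : Finset ℕ → R) : subsetSum x ∅ f = f ∅ := by
  simp [subsetSum]

theorem subsetSum_insert (x : R) {S : Finset ℕ} {i : ℕ} (hi : i ∉ S) (f : Finset ℕ → R) :
    subsetSum x (insert i S) f =
      (1 - x) * subsetSum x S f + x * subsetSum x S (fun W => f (insert i W)) := by
  rw [subsetSum, Finset.sum_powerset_insert hi, subsetSum, subsetSum, Finset.mul_sum,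
    Finset.mul_sum, Finset.card_insert_of_notMem hi]
  congr 1 <;> refine Finset.sum_congr rfl fun W hW => ?_
  · have := Finset.card_le_card (Finset.mem_powerset.1 hW)
    rw [Nat.succ_sub this, pow_succ]
    ring
  · rw [Finset.card_insert_of_notMem fun h => hi (Finset.mem_powerset.1 hW h),
      Nat.add_sub_add_right, pow_succ]
    ring

theorem subsetSum_const (x : R) (S : Finset ℕ) (c : R) : subsetSum x S (fun _ => c) = c := by
  induction S using Finset.induction_on with
  | empty => rw [subsetSum_empty]
  | insert i S hi ih => rw [subsetSum_insert x hi, ih]; ring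

/-- Independence of the random subsets of disjoint sets. -/
theorem subsetSum_union (x : R) {S T : Finset ℕ} (h : Disjoint S T) (f : Finset ℕ → R) :
    subsetSum x (S ∪ T) f = subsetSum x S fun A => subsetSum x T fun B => f (A ∪ B) := by
  induction S using Finset.induction_on generalizing f with
  | empty => simp [subsetSum_empty]
  | insert i S hi ih =>
    rw [Finset.disjoint_insert_left] at h
    rw [Finset.insert_union, subsetSum_insert x (by simp [hi, h.1]), ih h.2, ih h.2,
      subsetSum_insert x hi]
    simp only [Finset.insert_union]

theorem subsetSum_union_mul (x : R) {S T : Finset ℕ} (h : Disjoint S T) {f : Finset ℕ → R}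
    (g k : Finset ℕ → R) (hf : ∀ A ⊆ S, ∀ B ⊆ T, f (A ∪ B) = g A * k B) :
    subsetSum x (S ∪ T) f = subsetSum x S g * subsetSum x T k := by
  rw [subsetSum_union x h, ← subsetSum_mul_const]
  refine subsetSum_congr fun A hA => ?_
  rw [← subsetSum_const_mul]
  exact subsetSum_congr fun B hB => hf A hA B hB

end WeightedSum

/-! ### The binary heap -/

section Heap

/-- In the heap `{0, …, n - 1}`, where `i` has the children `2 i + 1` and `2 i + 2`, the component
of `i` in the part of the subtree of `i` that lies in `W`. It is empty if `i ∉ W`. -/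
def heapComp (n : ℕ) (W : Finset ℕ) (i : ℕ) : Finset ℕ :=
  if i < n ∧ i ∈ W then insert i (heapComp n W (2 * i + 1) ∪ heapComp n W (2 * i + 2)) else ∅
termination_by n - i
decreasing_by all_goals omega

/-- The vertices of the subtree of `i` in the heap `{0, …, n - 1}`. -/
def heapSub (n i : ℕ) : Finset ℕ := heapComp n (Finset.range n) i

variable {n : ℕ}

theorem heapComp_of_mem {W : Finset ℕ} {i : ℕ} (hi : i < n) (hW : i ∈ W) :
    heapComp n W i = insert i (heapComp n W (2 * i + 1) ∪ heapComp n W (2 * i + 2)) := by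
  rw [heapComp, if_pos ⟨hi, hW⟩]

theorem heapComp_of_notMem {W : Finset ℕ} {i : ℕ} (hW : i ∉ W) : heapComp n W i = ∅ := by
  rw [heapComp, if_neg fun h => hW h.2]

theorem heapComp_of_le {W : Finset ℕ} {i : ℕ} (hi : n ≤ i) : heapComp n W i = ∅ := by
  rw [heapComp, if_neg fun h => absurd h.1 (by omega)]

theorem heapComp_subset (W : Finset ℕ) (i : ℕ) : heapComp n W i ⊆ W := by
  induction i using heapComp.induct n W with
  | case1 i h ih1 ih2 =>
    rw [heapComp_of_mem h.1 h.2]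
    exact Finset.insert_subset h.2 (Finset.union_subset ih1 ih2)
  | case2 i h => rw [heapComp, if_neg h]; exact Finset.empty_subset _

theorem heapSub_subset_range (i : ℕ) : heapSub n i ⊆ Finset.range n := heapComp_subset _ _

theorem heapSub_of_lt {i : ℕ} (hi : i < n) :
    heapSub n i = insert i (heapSub n (2 * i + 1) ∪ heapSub n (2 * i + 2)) :=
  heapComp_of_mem hi (Finset.mem_range.2 hi)

theorem heapSub_of_le {i : ℕ} (hi : n ≤ i) : heapSub n i = ∅ := heapComp_of_le hi

/-- With the numbering shifted to start at one, the ancestors of a vertex are its quotients by the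
powers of two. -/
theorem exists_div_of_mem_heapSub {i j : ℕ} (h : j ∈ heapSub n i) :
    ∃ k, (j + 1) / 2 ^ k = i + 1 := by
  unfold heapSub at h
  induction i using heapComp.induct n (Finset.range n) with
  | case1 i hi ih1 ih2 =>
    rw [heapComp_of_mem hi.1 hi.2, Finset.mem_insert, Finset.mem_union] at h
    rcases h with rfl | h | h
    · exact ⟨0, by simp⟩
    · obtain ⟨k, hk⟩ := ih1 h
      exact ⟨k + 1, by rw [pow_succ, ← Nat.div_div_eq_div_mul, hk]; omega⟩
    · obtain ⟨k, hk⟩ := ih2 h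
      exact ⟨k + 1, by rw [pow_succ, ← Nat.div_div_eq_div_mul, hk]; omega⟩
  | case2 i hi => rw [heapComp, if_neg hi] at h; simp at h

theorem le_of_mem_heapSub {i j : ℕ} (h : j ∈ heapSub n i) : i ≤ j := by
  obtain ⟨k, hk⟩ := exists_div_of_mem_heapSub h
  have := Nat.div_le_self (j + 1) (2 ^ k)
  omega

theorem disjoint_heapSub_children (i : ℕ) :
    Disjoint (heapSub n (2 * i + 1)) (heapSub n (2 * i + 2)) := by
  rw [Finset.disjoint_left]
  intro j h1 h2
  obtain ⟨k, hk⟩ := exists_div_of_mem_heapSub h1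
  obtain ⟨l, hl⟩ := exists_div_of_mem_heapSub h2
  rcases lt_trichotomy k l with h | rfl | h
  · obtain ⟨d, rfl⟩ := Nat.exists_eq_add_of_lt h
    rw [show k + d + 1 = k + (d + 1) by ring, pow_add, ← Nat.div_div_eq_div_mul, hk] at hl
    have := Nat.div_le_self (2 * i + 1 + 1) (2 ^ (d + 1))
    omega
  · omega
  · obtain ⟨d, rfl⟩ := Nat.exists_eq_add_of_lt h
    rw [show l + d + 1 = l + (d + 1) by ring, pow_add, ← Nat.div_div_eq_div_mul, hl, pow_succ',
      ← Nat.div_div_eq_div_mul] at hk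
    have := Nat.div_le_self ((2 * i + 2 + 1) / 2) (2 ^ d)
    omega

theorem notMem_heapSub_children (i : ℕ) : i ∉ heapSub n (2 * i + 1) ∪ heapSub n (2 * i + 2) := by
  intro h
  rcases Finset.mem_union.1 h with h | h <;> have := le_of_mem_heapSub h <;> omega

theorem heapComp_subset_heapSub (W : Finset ℕ) (i : ℕ) : heapComp n W i ⊆ heapSub n i := by
  induction i using heapComp.induct n W with
  | case1 i h ih1 ih2 =>
    rw [heapComp_of_mem h.1 h.2, heapSub_of_lt h.1]
    exact Finset.insert_subset_insert _ (Finset.union_subset_union ih1 ih2)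
  | case2 i h => rw [heapComp, if_neg h]; exact Finset.empty_subset _

theorem heapComp_congr {A B : Finset ℕ} {i : ℕ} (h : ∀ j ∈ heapSub n i, (j ∈ A ↔ j ∈ B)) :
    heapComp n A i = heapComp n B i := by
  induction i using heapComp.induct n A with
  | case1 i hi ih1 ih2 =>
    rw [heapSub_of_lt hi.1] at h
    rw [heapComp_of_mem hi.1 hi.2,
      heapComp_of_mem hi.1 ((h i (Finset.mem_insert_self _ _)).1 hi.2),
      ih1 fun j hj => h j (by simp [hj]), ih2 fun j hj => h j (by simp [hj])]
  | case2 i hi =>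
    rw [heapComp, if_neg hi, heapComp, if_neg]
    rintro ⟨h1, h2⟩
    exact hi ⟨h1, (h i (by rw [heapSub_of_lt h1]; simp)).2 h2⟩

theorem heapComp_insert_union {i : ℕ} (hi : i < n) {A B : Finset ℕ}
    (hA : A ⊆ heapSub n (2 * i + 1)) (hB : B ⊆ heapSub n (2 * i + 2)) :
    heapComp n (insert i (A ∪ B)) i =
      insert i (heapComp n A (2 * i + 1) ∪ heapComp n B (2 * i + 2)) := by
  have hd := Finset.disjoint_left.1 (disjoint_heapSub_children (n := n) i)
  have hi' := notMem_heapSub_children (n := n) i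
  rw [Finset.mem_union, not_or] at hi'
  rw [heapComp_of_mem hi (Finset.mem_insert_self _ _)]
  congr 2 <;> refine heapComp_congr fun j hj => ?_
  · have : j ≠ i := fun h => hi'.1 (h ▸ hj)
    have : j ∉ B := fun h => hd hj (hB h)
    simp [*]
  · have : j ≠ i := fun h => hi'.2 (h ▸ hj)
    have : j ∉ A := fun h => hd (hA h) hj
    simp [*]

/-- The leaves of the heap `{0, …, n - 1}`. -/
def heapLeaves (n : ℕ) : Finset ℕ := (Finset.range n).filter fun i => n ≤ 2 * i + 1

/-- The component of `i` in `W` contains no leaf of the heap. -/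
def HeapCut (n : ℕ) (W : Finset ℕ) (i : ℕ) : Prop := Disjoint (heapComp n W i) (heapLeaves n)

theorem heapCut_of_notMem {W : Finset ℕ} {i : ℕ} (h : i ∉ W) : HeapCut n W i := by
  simp [HeapCut, heapComp_of_notMem h]

theorem heapCut_insert_union {i : ℕ} (hi : i < n) {A B : Finset ℕ}
    (hA : A ⊆ heapSub n (2 * i + 1)) (hB : B ⊆ heapSub n (2 * i + 2)) :
    HeapCut n (insert i (A ∪ B)) i ↔
      2 * i + 1 < n ∧ HeapCut n A (2 * i + 1) ∧ HeapCut n B (2 * i + 2) := by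
  rw [HeapCut, heapComp_insert_union hi hA hB, Finset.disjoint_insert_left,
    Finset.disjoint_union_left, HeapCut, HeapCut]
  simp [heapLeaves, hi]

theorem card_heapComp_insert_union {i : ℕ} (hi : i < n) {A B : Finset ℕ}
    (hA : A ⊆ heapSub n (2 * i + 1)) (hB : B ⊆ heapSub n (2 * i + 2)) :
    (heapComp n (insert i (A ∪ B)) i).card =
      (heapComp n A (2 * i + 1)).card + (heapComp n B (2 * i + 2)).card + 1 := by
  rw [heapComp_insert_union hi hA hB, Finset.card_insert_of_notMem, Finset.card_union_of_disjoint]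
  · exact (disjoint_heapSub_children i).mono (heapComp_subset_heapSub _ _)
      (heapComp_subset_heapSub _ _)
  · exact fun h => notMem_heapSub_children i (Finset.union_subset_union
      (heapComp_subset_heapSub _ _) (heapComp_subset_heapSub _ _) h)

variable {R : Type*} [CommRing R]

open Classical in
/-- `z ^ s` if the component of `i` in `W` has size `s` and contains no leaf, and `0` otherwise. -/
def cutWeight (n : ℕ) (z : R) (i : ℕ) (W : Finset ℕ) : R :=
  if HeapCut n W i then z ^ (heapComp n W i).card else 0

open Classical in
/-- The sum of `z ^ s` over the vertices `v ∈ W` whose removal from `W` cuts `i` off from the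
leaves, where `s` is the size of the component of `i` after the removal. -/
def pivotWeight (n : ℕ) (z : R) (i : ℕ) (W : Finset ℕ) : R :=
  ∑ v ∈ W, if HeapCut n W i then 0 else cutWeight n z i (W.erase v)

/-- The generating function (in `z`) of the size of the component of `i` on the event that it
contains no leaf, where the vertices are retained with probability `x`. -/
def cutGF (n : ℕ) (x z : R) (i : ℕ) : R := subsetSum x (heapSub n i) (cutWeight n z i)

/-- The generating function (in `z`) of the size of the component that is left after the removal
of a pivotal vertex, summed over all pivotal vertices. -/
def pivotGF (n : ℕ) (x z : R) (i : ℕ) : R := subsetSum x (heapSub n i) (pivotWeight n z i)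

theorem cutWeight_of_notMem (z : R) {W : Finset ℕ} {i : ℕ} (h : i ∉ W) :
    cutWeight n z i W = 1 := by
  rw [cutWeight, if_pos (heapCut_of_notMem h), heapComp_of_notMem h, Finset.card_empty, pow_zero]

theorem cutWeight_insert_union (z : R) {i : ℕ} (hi : i < n) {A B : Finset ℕ}
    (hA : A ⊆ heapSub n (2 * i + 1)) (hB : B ⊆ heapSub n (2 * i + 2)) :
    cutWeight n z i (insert i (A ∪ B)) =
      if 2 * i + 1 < n then z * (cutWeight n z (2 * i + 1) A * cutWeight n z (2 * i + 2) B)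
      else 0 := by
  have h := heapCut_insert_union hi hA hB
  simp only [cutWeight, card_heapComp_insert_union hi hA hB]
  by_cases h1 : 2 * i + 1 < n <;> by_cases h2 : HeapCut n A (2 * i + 1) <;>
    by_cases h3 : HeapCut n B (2 * i + 2) <;> simp only [h1, h2, h3, and_self, and_true,
      and_false, iff_true, iff_false] at h <;> simp [h1, h2, h3, h]
  ring

theorem pivotWeight_of_notMem (z : R) {W : Finset ℕ} {i : ℕ} (h : i ∉ W) :
    pivotWeight n z i W = 0 := by
  simp [pivotWeight, heapCut_of_notMem h]

theorem cutGF_of_le (x z : R) {i : ℕ} (hi : n ≤ i) : cutGF n x z i = 1 := by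
  rw [cutGF, heapSub_of_le hi, subsetSum_empty, cutWeight_of_notMem z (Finset.notMem_empty _)]

theorem pivotGF_of_le (x z : R) {i : ℕ} (hi : n ≤ i) : pivotGF n x z i = 0 := by
  rw [pivotGF, heapSub_of_le hi, subsetSum_empty, pivotWeight_of_notMem z (Finset.notMem_empty _)]

/-- Either `i` is removed, or it is retained and neither of its subtrees is connected to a leaf; the
latter is impossible if `i` is a leaf. -/
theorem cutGF_of_lt (x z : R) {i : ℕ} (hi : i < n) :
    cutGF n x z i = 1 - x + if 2 * i + 1 < n then
      x * z * (cutGF n x z (2 * i + 1) * cutGF n x z (2 * i + 2)) else 0 := by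
  rw [cutGF, heapSub_of_lt hi, subsetSum_insert x (notMem_heapSub_children i),
    subsetSum_congr (g := fun _ => 1) fun W hW =>
      cutWeight_of_notMem z fun h => notMem_heapSub_children i (hW h), subsetSum_const, mul_one]
  congr 1
  split_ifs with h
  · rw [subsetSum_union_mul x (disjoint_heapSub_children i)
      (fun A => z * cutWeight n z (2 * i + 1) A) (cutWeight n z (2 * i + 2)), subsetSum_const_mul]
    · simp only [cutGF]; ring
    · intro A hA B hB
      rw [cutWeight_insert_union z hi hA hB, if_pos h, mul_assoc]
  · rw [subsetSum_union x (disjoint_heapSub_children i), subsetSum_congr (g := fun _ => 0),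
      subsetSum_const, mul_zero]
    intro A hA
    rw [subsetSum_congr (g := fun _ => 0), subsetSum_const]
    intro B hB
    rw [cutWeight_insert_union z hi hA hB, if_neg h]

/-- The pivotal vertex is `i` itself, or it lies in one of the two subtrees while the other one is
cut off from the leaves. -/
theorem pivotWeight_insert_union (z : R) {i : ℕ} (hi : i < n) {A B : Finset ℕ}
    (hA : A ⊆ heapSub n (2 * i + 1)) (hB : B ⊆ heapSub n (2 * i + 2)) :
    pivotWeight n z i (insert i (A ∪ B)) = 1 - cutWeight n 1 i (insert i (A ∪ B)) +
      (z * (pivotWeight n z (2 * i + 1) A * cutWeight n z (2 * i + 2) B) +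
      z * (cutWeight n z (2 * i + 1) A * pivotWeight n z (2 * i + 2) B)) := by
  have hi' := notMem_heapSub_children (n := n) i
  have hiAB : i ∉ A ∪ B := fun h => hi' (Finset.union_subset_union hA hB h)
  have hAB : Disjoint A B := (disjoint_heapSub_children i).mono hA hB
  have hd := Finset.disjoint_left.1 hAB
  conv_lhs => rw [pivotWeight]
  rw [Finset.sum_insert hiAB, Finset.sum_union hAB]
  congr 1
  · rw [Finset.erase_insert hiAB, cutWeight_of_notMem z hiAB, cutWeight]
    split_ifs <;> simp
  · by_cases h : 2 * i + 1 < n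
    -- `i` is not a leaf
    · have hc := heapCut_insert_union hi hA hB
      rw [eq_true h, true_and] at hc
      congr 1
      · rw [pivotWeight, Finset.sum_mul, Finset.mul_sum]
        refine Finset.sum_congr rfl fun v hv => ?_
        have hvi : i ≠ v := fun e => hiAB (by simp [e, hv])
        rw [Finset.erase_insert_of_ne hvi, Finset.erase_union_distrib,
          Finset.erase_eq_of_notMem (hd hv), cutWeight_insert_union z hi
            ((Finset.erase_subset _ _).trans hA) hB, if_pos h]
        by_cases hA' : HeapCut n A (2 * i + 1) <;> by_cases hB' : HeapCut n B (2 * i + 2) <;>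
          simp [hc, hA', hB', cutWeight]
      · rw [pivotWeight, Finset.mul_sum, Finset.mul_sum]
        refine Finset.sum_congr rfl fun v hv => ?_
        have hvi : i ≠ v := fun e => hiAB (by simp [e, hv])
        rw [Finset.erase_insert_of_ne hvi, Finset.erase_union_distrib,
          Finset.erase_eq_of_notMem fun h => hd h hv, cutWeight_insert_union z hi
            hA ((Finset.erase_subset _ _).trans hB), if_pos h]
        by_cases hA' : HeapCut n A (2 * i + 1) <;> by_cases hB' : HeapCut n B (2 * i + 2) <;>
          simp [hc, hA', hB', cutWeight]
    · rw [heapSub_of_le (by omega), Finset.subset_empty] at hA hB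
      subst hA hB
      simp [pivotWeight]

/-- The first summand comes from the pivotal vertex `i`: `1 - cutGF n x 1 i` is the probability that
`i` is connected to a leaf. -/
theorem pivotGF_of_lt (x z : R) {i : ℕ} (hi : i < n) :
    pivotGF n x z i = 1 - cutGF n x 1 i +
      x * z * (pivotGF n x z (2 * i + 1) * cutGF n x z (2 * i + 2) +
        cutGF n x z (2 * i + 1) * pivotGF n x z (2 * i + 2)) := by
  have hdis := disjoint_heapSub_children (n := n) i
  have h1 : cutGF n x 1 i = 1 - x + x * subsetSum x
      (heapSub n (2 * i + 1) ∪ heapSub n (2 * i + 2)) (fun W => cutWeight n 1 i (insert i W)) := by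
    rw [cutGF, heapSub_of_lt hi, subsetSum_insert x (notMem_heapSub_children i),
      subsetSum_congr (g := fun _ => 1) fun W hW =>
        cutWeight_of_notMem 1 fun h => notMem_heapSub_children i (hW h), subsetSum_const, mul_one]
  rw [h1, pivotGF, heapSub_of_lt hi, subsetSum_insert x (notMem_heapSub_children i),
    subsetSum_congr (g := fun _ => 0) fun W hW =>
      pivotWeight_of_notMem z fun h => notMem_heapSub_children i (hW h), subsetSum_const]
  have h2 : subsetSum x (heapSub n (2 * i + 1) ∪ heapSub n (2 * i + 2))
      (fun W => pivotWeight n z i (insert i W)) =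
      1 - subsetSum x (heapSub n (2 * i + 1) ∪ heapSub n (2 * i + 2))
        (fun W => cutWeight n 1 i (insert i W)) +
      (z * (pivotGF n x z (2 * i + 1) * cutGF n x z (2 * i + 2)) +
      z * (cutGF n x z (2 * i + 1) * pivotGF n x z (2 * i + 2))) := by
    rw [subsetSum_union x hdis, subsetSum_congr fun A hA => subsetSum_congr fun B hB =>
      pivotWeight_insert_union z hi hA hB]
    simp only [subsetSum_add, subsetSum_const_mul, subsetSum_mul_const, sub_eq_add_neg,
      ← neg_one_mul (cutWeight _ _ _ _), subsetSum_const]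
    rw [subsetSum_union x hdis]
    simp only [cutGF, pivotGF]
    ring
  rw [h2]
  ring

theorem map_cutGF {R' : Type*} [CommRing R'] (f : R →+* R') (x z : R) (i : ℕ) :
    f (cutGF n x z i) = cutGF n (f x) (f z) i := by
  simp only [cutGF, subsetSum, cutWeight, map_sum, map_mul, map_pow, map_sub, map_one, apply_ite f,
    map_zero]

end Heap

/-! ### Identification of the two binary trees with heaps -/

section Labelling

/-- `j` is one of the two children of `i` in the infinite heap. -/
def HeapChild (i j : ℕ) : Prop := j = 2 * i + 1 ∨ j = 2 * i + 2

/-- The map `ι` identifies the rooted tree `(G, r)` with the heap `{0, …, n - 1}`. -/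
structure HeapLabelling {V : Type} [Fintype V] (G : SimpleGraph V) (r : V) (n : ℕ)
    (ι : V ↪ ℕ) : Prop where
  map_univ : Finset.univ.map ι = Finset.range n
  root : ι r = 0
  adj : ∀ u v, G.Adj u v ↔ HeapChild (ι u) (ι v) ∨ HeapChild (ι v) (ι u)

theorem HeapChild.log_eq {i j : ℕ} (h : HeapChild i j) :
    Nat.log 2 (j + 1) = Nat.log 2 (i + 1) + 1 := by
  have h1 : (j + 1) / 2 = i + 1 := by rcases h with rfl | rfl <;> omega
  have h2 : 2 ≤ j + 1 := by rcases h with rfl | rfl <;> omega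
  rw [Nat.log_of_one_lt_of_le one_lt_two h2, h1]

theorem HeapChild.lt {i j : ℕ} (h : HeapChild i j) : i < j := by
  rcases h with rfl | rfl <;> omega

theorem exists_heapChild {j : ℕ} (h : j ≠ 0) : ∃ i, HeapChild i j :=
  ⟨(j - 1) / 2, by unfold HeapChild; omega⟩

theorem HeapChild.eq_of_eq {i i' j : ℕ} (h : HeapChild i j) (h' : HeapChild i' j) : i = i' := by
  rcases h with h | h <;> rcases h' with h' | h' <;> omega

theorem mem_heapComp_of_heapChild {n : ℕ} {W : Finset ℕ} {i j k : ℕ} (hj : j ∈ heapComp n W i)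
    (hjk : HeapChild j k) (hk : k < n) (hW : k ∈ W) : k ∈ heapComp n W i := by
  induction i using heapComp.induct n W with
  | case1 i h ih1 ih2 =>
    rw [heapComp_of_mem h.1 h.2, Finset.mem_insert, Finset.mem_union] at hj ⊢
    rcases hj with rfl | hj | hj
    · right
      rcases hjk with rfl | rfl
      · left
        rw [heapComp_of_mem hk hW]
        exact Finset.mem_insert_self _ _
      · right
        rw [heapComp_of_mem hk hW]
        exact Finset.mem_insert_self _ _
    · exact .inr (.inl (ih1 hj))
    · exact .inr (.inr (ih2 hj))
  | case2 i h => rw [heapComp, if_neg h] at hj; simp at hj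

theorem mem_heapComp_of_heapChild' {n : ℕ} {W : Finset ℕ} {i j k : ℕ} (hk : k ∈ heapComp n W i)
    (hjk : HeapChild j k) (hki : k ≠ i) : j ∈ heapComp n W i := by
  induction i using heapComp.induct n W with
  | case1 i h ih1 ih2 =>
    rw [heapComp_of_mem h.1 h.2, Finset.mem_insert, Finset.mem_union] at hk ⊢
    rcases hk with rfl | hk | hk
    · exact absurd rfl hki
    · by_cases hk' : k = 2 * i + 1
      · exact .inl (hjk.eq_of_eq (.inl hk'))
      · exact .inr (.inl (ih1 hk hk'))
    · by_cases hk' : k = 2 * i + 2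
      · exact .inl (hjk.eq_of_eq (.inr hk'))
      · exact .inr (.inr (ih2 hk hk'))
  | case2 i h => rw [heapComp, if_neg h] at hk; simp at hk

namespace HeapLabelling

variable {V : Type} [Fintype V] {G : SimpleGraph V} {r : V} {n : ℕ} {ι : V ↪ ℕ}

theorem lt (H : HeapLabelling G r n ι) (v : V) : ι v < n := by
  rw [← Finset.mem_range, ← H.map_univ]
  simp

theorem exists_eq (H : HeapLabelling G r n ι) {j : ℕ} (hj : j < n) : ∃ v, ι v = j := by
  rw [← Finset.mem_range, ← H.map_univ] at hj
  simpa using hj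

theorem log_le_add_length (H : HeapLabelling G r n ι) {u v : V} (p : G.Walk u v) :
    Nat.log 2 (ι v + 1) ≤ Nat.log 2 (ι u + 1) + p.length := by
  induction p with
  | nil => simp
  | cons h p ih =>
    rw [SimpleGraph.Walk.length_cons]
    rcases (H.adj _ _).1 h with h | h <;> have := h.log_eq <;> omega

theorem exists_walk (H : HeapLabelling G r n ι) (v : V) :
    ∃ p : G.Walk r v, p.length = Nat.log 2 (ι v + 1) := by
  induction hk : ι v using Nat.strong_induction_on generalizing v with
  | _ k ih =>
    subst hk
    by_cases h0 : ι v = 0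
    · obtain rfl : r = v := ι.injective (H.root.trans h0.symm)
      exact ⟨.nil, by simp [h0]⟩
    · obtain ⟨i, hi⟩ := exists_heapChild h0
      obtain ⟨u, rfl⟩ := H.exists_eq (hi.lt.trans (H.lt v))
      obtain ⟨p, hp⟩ := ih _ hi.lt u rfl
      exact ⟨p.concat ((H.adj _ _).2 (.inl hi)), by rw [SimpleGraph.Walk.length_concat, hp,
        hi.log_eq]⟩

theorem dist_eq (H : HeapLabelling G r n ι) (v : V) : G.dist r v = Nat.log 2 (ι v + 1) := by
  obtain ⟨p, hp⟩ := H.exists_walk v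
  refine le_antisymm (hp ▸ SimpleGraph.dist_le p) ?_
  obtain ⟨q, hq⟩ := p.reachable.exists_walk_length_eq_dist
  have := H.log_le_add_length q
  rw [H.root, zero_add, Nat.log_one_right, zero_add] at this
  omega

theorem mem_children (H : HeapLabelling G r n ι) {w v : V} :
    v ∈ children G r w ↔ HeapChild (ι w) (ι v) := by
  simp only [children, Finset.mem_filter, Finset.mem_univ, true_and, H.dist_eq, H.adj]
  refine ⟨fun ⟨h, hd⟩ => h.resolve_right fun h' => ?_, fun h => ⟨.inl h, h.log_eq⟩⟩
  have := h'.log_eq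
  omega

theorem map_children (H : HeapLabelling G r n ι) (w : V) :
    (children G r w).map ι = ({2 * ι w + 1, 2 * ι w + 2} : Finset ℕ).filter (· < n) := by
  ext j
  simp only [Finset.mem_map, H.mem_children, Finset.mem_filter, Finset.mem_insert,
    Finset.mem_singleton]
  constructor
  · rintro ⟨v, hv, rfl⟩
    exact ⟨hv, H.lt v⟩
  · rintro ⟨h, hj⟩
    obtain ⟨v, rfl⟩ := H.exists_eq hj
    exact ⟨v, h, rfl⟩

theorem children_eq_empty_iff (H : HeapLabelling G r n ι) (w : V) :
    children G r w = ∅ ↔ n ≤ 2 * ι w + 1 := by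
  rw [← Finset.map_eq_empty (f := ι), H.map_children, Finset.filter_eq_empty_iff]
  constructor
  · intro h
    simpa using h (Finset.mem_insert_self _ _)
  · intro h j hj
    simp only [Finset.mem_insert, Finset.mem_singleton] at hj
    omega

theorem map_leaves (H : HeapLabelling G r n ι) : (leaves G r).map ι = heapLeaves n := by
  ext j
  simp only [leaves, Finset.mem_map, Finset.mem_filter, Finset.mem_univ, true_and,
    H.children_eq_empty_iff, heapLeaves, Finset.mem_range]
  constructor
  · rintro ⟨v, hv, rfl⟩
    exact ⟨H.lt v, hv⟩
  · rintro ⟨hj, h⟩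
    obtain ⟨v, rfl⟩ := H.exists_eq hj
    exact ⟨v, h, rfl⟩

theorem map_keepSources (H : HeapLabelling G r n ι) (W : Finset V) :
    (keepSources G {r} W).map ι = heapComp n (W.map ι) 0 := by
  apply Finset.Subset.antisymm
  · intro j hj
    simp only [Finset.mem_map, mem_keepSources, Finset.mem_singleton, exists_eq_left] at hj
    obtain ⟨v, ⟨p, hp⟩, rfl⟩ := hj
    -- the component is closed under the steps of a walk in `W`
    have key : ∀ {u v : V} (p : G.Walk u v), (∀ w ∈ p.support, w ∈ W) →
        ι u ∈ heapComp n (W.map ι) 0 → ι v ∈ heapComp n (W.map ι) 0 := by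
      intro u v p
      induction p with
      | nil => exact fun _ h => h
      | cons h p ih =>
        intro hp hu
        simp only [SimpleGraph.Walk.support_cons, List.mem_cons, forall_eq_or_imp] at hp
        refine ih hp.2 ?_
        rcases (H.adj _ _).1 h with h | h
        · exact mem_heapComp_of_heapChild hu h (H.lt _)
            (Finset.mem_map_of_mem ι (hp.2 _ p.start_mem_support))
        · exact mem_heapComp_of_heapChild' hu h (by have := h.lt; omega)
    refine key p hp ?_
    rw [H.root, heapComp_of_mem (H.root ▸ H.lt r)
      (H.root ▸ Finset.mem_map_of_mem ι (hp r p.start_mem_support))]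
    exact Finset.mem_insert_self _ _
  · -- a subtree is kept as soon as its root, if retained, is kept
    have key : ∀ i, (∀ v, ι v = i → v ∈ W → v ∈ keepSources G {r} W) →
        heapComp n (W.map ι) i ⊆ (keepSources G {r} W).map ι := by
      intro i
      induction i using heapComp.induct n (W.map ι) with
      | case1 i h ih1 ih2 =>
        intro hi
        obtain ⟨v, hv, rfl⟩ := Finset.mem_map.1 h.2
        have hv' := hi v rfl hv
        have hstep : ∀ w, HeapChild (ι v) (ι w) → w ∈ W → w ∈ keepSources G {r} W := by
          intro w hw hwW
          rw [mem_keepSources] at hv' ⊢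
          obtain ⟨s, hs, p, hp⟩ := hv'
          refine ⟨s, hs, p.concat ((H.adj _ _).2 (.inl hw)), fun u hu => ?_⟩
          rw [SimpleGraph.Walk.support_concat, List.mem_append] at hu
          rcases hu with hu | hu
          · exact hp u hu
          · rw [List.mem_singleton.1 hu]
            exact hwW
        rw [heapComp_of_mem h.1 h.2]
        exact Finset.insert_subset (Finset.mem_map_of_mem ι hv') (Finset.union_subset
          (ih1 fun w hw => hstep w (.inl hw)) (ih2 fun w hw => hstep w (.inr hw)))
      | case2 i h => intro _; rw [heapComp, if_neg h]; exact Finset.empty_subset _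
    refine key 0 fun v hv hvW => ?_
    obtain rfl : r = v := ι.injective (H.root.trans hv.symm)
    rw [mem_keepSources]
    exact ⟨r, Finset.mem_singleton_self r, .nil, by simpa using hvW⟩

theorem heapSub_zero (H : HeapLabelling G r n ι) : heapSub n 0 = Finset.range n := by
  refine (heapSub_subset_range 0).antisymm ?_
  rw [heapSub, ← H.map_univ, ← H.map_keepSources, Finset.map_subset_map]
  intro v _
  obtain ⟨p, -⟩ := H.exists_walk v
  rw [mem_keepSources]
  exact ⟨r, Finset.mem_singleton_self r, p, fun _ _ => Finset.mem_univ _⟩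

theorem keepSources_univ (H : HeapLabelling G r n ι) :
    keepSources G {r} Finset.univ = Finset.univ := by
  rw [← Finset.map_inj (f := ι), H.map_keepSources, H.map_univ]
  exact H.heapSub_zero

theorem leaves_nonempty (H : HeapLabelling G r n ι) : (leaves G r).Nonempty := by
  have := H.root ▸ H.lt r
  rw [← Finset.map_nonempty (f := ι), H.map_leaves]
  exact ⟨n - 1, by simp only [heapLeaves, Finset.mem_filter, Finset.mem_range]; omega⟩

theorem card_eq (H : HeapLabelling G r n ι) : Fintype.card V = n := by
  rw [← Finset.card_univ, ← Finset.card_map ι, H.map_univ, Finset.card_range]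

theorem disjoint_keepSources_iff (H : HeapLabelling G r n ι) (W : Finset V) :
    Disjoint (keepSources G {r} W) (leaves G r) ↔ HeapCut n (W.map ι) 0 := by
  rw [HeapCut, ← H.map_keepSources, ← H.map_leaves, Finset.disjoint_map]

/-- The tree polynomial at `x` is the probability that the root is connected to a leaf when the
vertices are retained with probability `x`. -/
theorem aeval_vertexPoly (H : HeapLabelling G r n ι) (x : ℝ) (w : V) :
    aeval x (vertexPoly G r w) = 1 - cutGF n x 1 (ι w) := by
  induction w using vertexPoly.induct G r with
  | case1 w h =>
    rw [vertexPoly, if_pos h, aeval_X, cutGF_of_lt x 1 (H.lt w),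
      if_neg (not_lt.2 ((H.children_eq_empty_iff w).1 h))]
    ring
  | case2 w h ih =>
    have hlt := not_le.1 ((H.children_eq_empty_iff w).not.1 h)
    have hprod : ∏ v : {v // v ∈ children G r w}, aeval x (1 - vertexPoly G r v.1) =
        cutGF n x 1 (2 * ι w + 1) * cutGF n x 1 (2 * ι w + 2) := by
      rw [Finset.prod_congr rfl (g := fun v : {v // v ∈ children G r w} => cutGF n x 1 (ι v.1))
        fun v _ => by rw [map_sub, map_one, ih v, sub_sub_cancel],
        Finset.prod_coe_sort (children G r w) (fun v => cutGF n x 1 (ι v)),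
        ← Finset.prod_map (children G r w) ι (fun j => cutGF n x 1 j), H.map_children,
        Finset.prod_filter_of_ne, Finset.prod_pair (by omega)]
      intro j _ hj
      by_contra hj'
      exact hj (cutGF_of_le x 1 (not_lt.1 hj'))
    rw [vertexPoly, if_neg h, map_mul, map_sub, map_one, map_prod, aeval_X, hprod,
      cutGF_of_lt x 1 (H.lt w), if_pos hlt]
    ring

variable [DecidableEq V]

theorem pivotCount_eq (H : HeapLabelling G r n ι) (m : ℕ) (W : Finset V) :
    (pivotCount G {r} (leaves G r) m W : ℝ) = (pivotWeight n (X : ℝ[X]) 0 (W.map ι)).coeff m := by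
  rw [pivotWeight, Finset.sum_map, finsetSum_coeff, pivotCount, Finset.card_filter]
  push_cast
  refine Finset.sum_congr rfl fun v _ => ?_
  have hcard : (keepSources G {r} (W.erase v)).card =
      (heapComp n ((W.map ι).erase (ι v)) 0).card := by
    rw [← Finset.map_erase, ← H.map_keepSources, Finset.card_map]
  have hW := H.disjoint_keepSources_iff W
  have hWv := H.disjoint_keepSources_iff (W.erase v)
  rw [Finset.map_erase] at hWv
  rw [cutWeight, hcard]
  by_cases h1 : HeapCut n (W.map ι) 0
  · simp [hW, h1]
  · by_cases h2 : HeapCut n ((W.map ι).erase (ι v)) 0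
    · simp [hW, hWv, h1, h2, coeff_X_pow, eq_comm (a := m)]
    · simp [hW, hWv, h1, h2]

/-- The law of the size of the separation subgraph of a heap, through the generating function of
the pivotal vertices. -/
theorem treeSeparationSizeLaw_real_singleton (H : HeapLabelling G r n ι) (m : ℕ) :
    ((treeSeparationSizeLaw G r : ProbabilityMeasure ℕ) : Measure ℕ).real {m} =
      ∫ x in (0 : ℝ)..1, x⁻¹ * (pivotGF n (C x) X 0).coeff m := by
  rw [treeSeparationSizeLaw, separationSizeLaw_real_singleton G {r} (leaves G r) m
    H.keepSources_univ H.leaves_nonempty]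
  refine intervalIntegral.integral_congr fun x _ => ?_
  rw [pivotGF, H.heapSub_zero, subsetSum, finsetSum_coeff, ← H.map_univ,
    ← Finset.powerset_univ, H.card_eq, Finset.card_map, Finset.card_univ, H.card_eq]
  congr 1
  refine Finset.sum_bij (fun W _ => W.map ι) ?_ ?_ ?_ ?_
  · intro W _
    rw [Finset.mem_powerset, Finset.map_subset_map]
    exact Finset.subset_univ W
  · intro W _ W' _ h
    exact Finset.map_injective ι h
  · intro W hW
    obtain ⟨W', -, rfl⟩ := Finset.subset_map_iff.1 (Finset.mem_powerset.1 hW)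
    exact ⟨W', by simp, rfl⟩
  · intro W _
    rw [H.pivotCount_eq, Finset.card_map, ← C_1, ← C_sub, ← C_pow, ← C_pow, ← C_mul, coeff_C_mul]

end HeapLabelling

theorem heapLabelling_completeBinaryTree (n : ℕ) :
    HeapLabelling (completeBinaryTree (n + 1)) 0 (n + 1) Fin.valEmbedding where
  map_univ := by
    ext j
    simp only [Finset.mem_map, Finset.mem_univ, true_and, Finset.mem_range, Fin.valEmbedding_apply]
    exact ⟨fun ⟨v, hv⟩ => hv ▸ v.2, fun h => ⟨⟨j, h⟩, rfl⟩⟩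
  root := rfl
  adj u v := by
    rw [completeBinaryTree, SimpleGraph.fromRel_adj]
    refine ⟨fun h => h.2, fun h => ⟨?_, h⟩⟩
    rintro rfl
    rcases h with h | h <;> exact h.lt.ne rfl

/-- The index `2 ^ h - 1 + j` of the `j`-th vertex at height `h` in the level order. -/
def levelIndex (n : ℕ) : FullVertex n ↪ ℕ where
  toFun v := 2 ^ v.1.val - 1 + v.2.val
  inj' := by
    have key : ∀ v : FullVertex n, Nat.log 2 (2 ^ v.1.val - 1 + v.2.val + 1) = v.1.val := by
      intro v
      have := v.2.2
      have := Nat.one_le_two_pow (n := v.1.val)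
      rw [Nat.log_eq_iff (by simp), pow_succ]
      omega
    rintro ⟨⟨h, hh⟩, ⟨j, hj⟩⟩ ⟨⟨h', hh'⟩, ⟨j', hj'⟩⟩ e
    obtain rfl : h = h' := (key ⟨⟨h, hh⟩, ⟨j, hj⟩⟩).symm.trans
      ((congrArg (fun a => Nat.log 2 (a + 1)) e).trans (key ⟨⟨h', hh'⟩, ⟨j', hj'⟩⟩))
    simp only [Nat.add_left_cancel_iff] at e
    subst e
    rfl

theorem levelIndex_add_one {n : ℕ} (v : FullVertex n) :
    levelIndex n v + 1 = 2 ^ v.1.val + v.2.val := by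
  have := Nat.one_le_two_pow (n := v.1.val)
  change 2 ^ v.1.val - 1 + v.2.val + 1 = _
  omega

theorem log_levelIndex {n : ℕ} (v : FullVertex n) : Nat.log 2 (levelIndex n v + 1) = v.1.val := by
  have := v.2.2
  rw [levelIndex_add_one, Nat.log_eq_iff (by simp), pow_succ]
  omega

theorem heapLabelling_fullBinaryTree (n : ℕ) :
    HeapLabelling (fullBinaryTree (n + 1)) (fullRoot n) (2 ^ (n + 1) - 1) (levelIndex (n + 1)) where
  map_univ := by
    ext j
    simp only [Finset.mem_map, Finset.mem_univ, true_and, Finset.mem_range]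
    constructor
    · rintro ⟨v, rfl⟩
      have h1 := levelIndex_add_one v
      have h2 := v.2.2
      have h3 : 2 ^ (v.1.val + 1) ≤ 2 ^ (n + 1) := Nat.pow_le_pow_right two_pos v.1.2
      rw [pow_succ] at h3
      omega
    · intro hj
      have h1 := Nat.pow_log_le_self 2 (x := j + 1) (by simp)
      have h2 := Nat.lt_pow_succ_log_self one_lt_two (j + 1)
      rw [pow_succ] at h2
      have h3 : Nat.log 2 (j + 1) < n + 1 := Nat.log_lt_of_lt_pow (by simp) (by omega)
      refine ⟨⟨⟨Nat.log 2 (j + 1), h3⟩, ⟨j + 1 - 2 ^ Nat.log 2 (j + 1), ?_⟩⟩, ?_⟩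
      · change j + 1 - 2 ^ Nat.log 2 (j + 1) < 2 ^ Nat.log 2 (j + 1)
        omega
      · have := levelIndex_add_one (n := n + 1) ⟨⟨Nat.log 2 (j + 1), h3⟩,
          ⟨j + 1 - 2 ^ Nat.log 2 (j + 1), by change _ < 2 ^ Nat.log 2 (j + 1); omega⟩⟩
        simp only at this
        omega
  root := by
    have := levelIndex_add_one (fullRoot n)
    simpa [fullRoot] using this
  adj u v := by
    have key : ∀ u v : FullVertex (n + 1), (v.1.val = u.1.val + 1 ∧
        (v.2.val = 2 * u.2.val ∨ v.2.val = 2 * u.2.val + 1)) ↔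
        HeapChild (levelIndex (n + 1) u) (levelIndex (n + 1) v) := by
      intro u v
      have hu := levelIndex_add_one u
      have hv := levelIndex_add_one v
      constructor
      · rintro ⟨h1, h2⟩
        have h3 : 2 ^ v.1.val = 2 * 2 ^ u.1.val := by rw [h1, pow_succ']
        unfold HeapChild
        omega
      · intro h
        have h1 := h.log_eq
        rw [log_levelIndex, log_levelIndex] at h1
        have h3 : 2 ^ v.1.val = 2 * 2 ^ u.1.val := by rw [h1, pow_succ']
        unfold HeapChild at h
        exact ⟨h1, by omega⟩
    rw [fullBinaryTree, SimpleGraph.fromRel_adj, key, key]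
    refine ⟨fun h => h.2, fun h => ⟨?_, h⟩⟩
    rintro rfl
    rcases h with h | h <;> exact h.lt.ne rfl

end Labelling

/-! ### Convergence of the tree polynomials -/

section Limit

theorem phi_of_le_half {x : ℝ} (h0 : 0 ≤ x) (h : x ≤ 1 / 2) : phi x = 0 := by
  rw [phi]
  split_ifs with hx
  · rfl
  · have hx0 : 0 < x := lt_of_le_of_ne h0 (Ne.symm hx)
    refine max_eq_left ?_
    rw [sub_nonpos, le_div_iff₀ hx0]
    linarith

theorem phi_of_half_le {x : ℝ} (h : 1 / 2 ≤ x) : phi x = 2 - 1 / x := by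
  have hx0 : 0 < x := by linarith
  rw [phi, if_neg hx0.ne']
  refine max_eq_right ?_
  rw [sub_nonneg, div_le_iff₀ hx0]
  linarith

theorem mul_phi_of_half_le {x : ℝ} (h : 1 / 2 ≤ x) : x * phi x = 2 * x - 1 := by
  have hx0 : x ≠ 0 := by linarith
  rw [phi_of_half_le h]
  field_simp

theorem phi_nonneg (x : ℝ) : 0 ≤ phi x := by
  rw [phi]
  split_ifs
  · exact le_rfl
  · exact le_max_left _ _

theorem phi_le_one {x : ℝ} (h0 : 0 ≤ x) (h1 : x ≤ 1) : phi x ≤ 1 := by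
  rcases le_total x (1 / 2) with h | h
  · rw [phi_of_le_half h0 h]
    exact zero_le_one
  · have := mul_phi_of_half_le h
    have := phi_nonneg x
    nlinarith

/-- `φ(x)` is a fixed point of the recursion of the full binary tree. -/
theorem phi_fixed {x : ℝ} (h0 : 0 ≤ x) : x * (1 - (1 - phi x) * (1 - phi x)) = phi x := by
  rcases le_total x (1 / 2) with h | h
  · rw [phi_of_le_half h0 h]
    ring
  · linear_combination -phi x * mul_phi_of_half_le h

theorem mul_one_sub_phi_le {x : ℝ} (h0 : 0 ≤ x) : x * (1 - phi x) ≤ 1 / 2 := by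
  rcases le_total x (1 / 2) with h | h
  · rw [phi_of_le_half h0 h]
    linarith
  · have := mul_phi_of_half_le h
    linarith

/-- The value at `x` of the tree polynomial of the full binary tree of height `k`. -/
def fullIter (x : ℝ) : ℕ → ℝ
  | 0 => x
  | k + 1 => x * (1 - (1 - fullIter x k) * (1 - fullIter x k))

/-- The iterates of the full binary tree decrease to `φ`, at a rate that is uniform in `x`. -/
theorem fullIter_bounds {x : ℝ} (h0 : 0 ≤ x) (h1 : x ≤ 1) (k : ℕ) :
    phi x ≤ fullIter x k ∧ fullIter x k ≤ 1 ∧ fullIter x k - phi x ≤ 2 / (k + 2) := by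
  induction k with
  | zero =>
    have hp := phi_nonneg x
    refine ⟨?_, h1, by simp [fullIter]; linarith⟩
    rcases le_total x (1 / 2) with h | h
    · rw [phi_of_le_half h0 h]
      exact h0
    · have := mul_phi_of_half_le h
      simp only [fullIter]
      nlinarith [sq_nonneg (x - 1)]
  | succ k ih =>
    obtain ⟨ha, hb, hc⟩ := ih
    have hp := phi_nonneg x
    have hf := phi_fixed h0
    simp only [fullIter]
    set u := fullIter x k with hu
    -- the error `e` of one iterate becomes at most `e * (1 - e / 2)` in the next one
    have he : x * (1 - (1 - u) * (1 - u)) - phi x = (u - phi x) * (x * (2 - phi x - u)) := by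
      linear_combination hf
    have hmul : x * (2 - phi x - u) ≤ 1 - (u - phi x) / 2 := by
      rcases le_total x (1 / 2) with h | h
      · rw [phi_of_le_half h0 h]
        nlinarith
      · have := mul_phi_of_half_le h
        nlinarith
    have hnn : 0 ≤ x * (2 - phi x - u) := mul_nonneg h0 (by linarith)
    refine ⟨?_, ?_, ?_⟩
    · have := mul_nonneg (sub_nonneg.2 ha) hnn
      linarith
    · have : 0 ≤ (1 - u) * (1 - u) := mul_self_nonneg _
      nlinarith
    · rw [he]
      have ht : (2 : ℝ) / (k + 2) ≤ 1 := by
        rw [div_le_one (by positivity)]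
        linarith [k.cast_nonneg (α := ℝ)]
      have h2 : (2 : ℝ) / (k + 2) * (1 - 2 / (k + 2) / 2) ≤ 2 / (((k + 1 : ℕ) : ℝ) + 2) := by
        have : (0 : ℝ) ≤ k := k.cast_nonneg
        rw [← sub_nonneg]
        have : (2 : ℝ) / (((k + 1 : ℕ) : ℝ) + 2) - 2 / (k + 2) * (1 - 2 / (k + 2) / 2) =
            2 / ((k + 3) * (k + 2) ^ 2) := by
          push_cast
          have : (k : ℝ) + 1 + 2 ≠ 0 := by positivity
          have : (k : ℝ) + 3 ≠ 0 := by positivity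
          field_simp
          ring
        rw [this]
        positivity
      refine le_trans ?_ h2
      set t := (2 : ℝ) / (k + 2)
      have h3 := mul_le_mul_of_nonneg_left hmul (sub_nonneg.2 ha)
      nlinarith [mul_nonneg (sub_nonneg.2 hc) (show 0 ≤ 1 - (t + (u - phi x)) / 2 by linarith)]

theorem cutGF_bounds {x : ℝ} (h0 : 0 ≤ x) (h1 : x ≤ 1) (n i : ℕ) :
    0 ≤ cutGF n x 1 i ∧ cutGF n x 1 i ≤ 1 := by
  induction hk : n - i using Nat.strong_induction_on generalizing i with
  | _ k ih =>
    rcases le_or_gt n i with hi | hi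
    · rw [cutGF_of_le x 1 hi]
      exact ⟨zero_le_one, le_rfl⟩
    · rw [cutGF_of_lt x 1 hi]
      obtain ⟨a0, a1⟩ := ih (n - (2 * i + 1)) (by omega) (2 * i + 1) rfl
      obtain ⟨b0, b1⟩ := ih (n - (2 * i + 2)) (by omega) (2 * i + 2) rfl
      have h3 := mul_nonneg a0 b0
      have h4 := mul_le_one₀ a1 b0 b1
      split_ifs
      · constructor <;> nlinarith
      · constructor <;> linarith

/-- The hypotheses say that the subtree of `i` is full of height `k`: the last of its possible vertices
at height `k` exists, and the first one at height `k + 1` does not. -/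
theorem cutGF_of_perfect (x : ℝ) {n i k : ℕ} (h1 : (i + 2) * 2 ^ k < n + 2)
    (h2 : n < (i + 1) * 2 ^ (k + 1)) : cutGF n x 1 i = 1 - fullIter x k := by
  induction k generalizing i with
  | zero =>
    rw [cutGF_of_lt x 1 (by omega), if_neg (by omega), fullIter]
    ring
  | succ k ih =>
    have hp := Nat.one_le_two_pow (n := k)
    rw [pow_succ] at h1 h2
    have hlt : 2 * i + 1 < n := by nlinarith
    rw [cutGF_of_lt x 1 (by omega), if_pos hlt, ih (by nlinarith) (by nlinarith),
      ih (by nlinarith) (by nlinarith), fullIter]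
    ring

/-- One step of the recursion, where the error of one subtree is halved. The constant `1 / 2` is the
maximum of `x * (1 - φ(x))`. -/
theorem abs_step_le {x u a d : ℝ} (h0 : 0 ≤ x) (h1 : x ≤ 1) (ha0 : 0 ≤ a) (ha1 : a ≤ 1)
    (hu : |1 - u - phi x| ≤ d) :
    |1 - (1 - x + x * 1 * (u * a)) - phi x| ≤ 1 / 2 * |1 - a - phi x| + d := by
  have hf := phi_fixed h0
  have e : 1 - (1 - x + x * 1 * (u * a)) - phi x =
      x * (1 - phi x) * (1 - a - phi x) + x * a * (1 - u - phi x) := by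
    linear_combination hf
  have h2 : 0 ≤ x * (1 - phi x) := mul_nonneg h0 (sub_nonneg.2 (phi_le_one h0 h1))
  rw [e]
  refine (abs_add_le _ _).trans ?_
  rw [abs_mul, abs_mul (x * a), abs_of_nonneg h2, abs_of_nonneg (mul_nonneg h0 ha0)]
  refine add_le_add (mul_le_mul_of_nonneg_right (mul_one_sub_phi_le h0) (abs_nonneg _)) ?_
  have := mul_le_of_le_one_left (abs_nonneg (1 - u - phi x)) (mul_le_one₀ h1 ha0 ha1)
  linarith

theorem abs_cutGF_sub_le_one {x : ℝ} (h0 : 0 ≤ x) (h1 : x ≤ 1) (n i : ℕ) :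
    |1 - cutGF n x 1 i - phi x| ≤ 1 := by
  obtain ⟨ha, hb⟩ := cutGF_bounds h0 h1 n i
  have := phi_nonneg x
  have := phi_le_one h0 h1
  rw [abs_le]
  constructor <;> linarith

theorem abs_perfect_sub_le {x : ℝ} (h0 : 0 ≤ x) (h1 : x ≤ 1) {n i k : ℕ}
    (hn : (i + 2) * 2 ^ k < n + 2) (hn' : n < (i + 1) * 2 ^ (k + 1)) :
    |1 - cutGF n x 1 i - phi x| ≤ 2 / (k + 2) := by
  obtain ⟨ha, -, hc⟩ := fullIter_bounds h0 h1 k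
  rw [cutGF_of_perfect x hn hn', sub_sub_cancel, abs_of_nonneg (sub_nonneg.2 ha)]
  exact hc

/-- The subtree of `i` has height `k`. One of its two subtrees is full, hence within
`2 / (k' + 2)` of `φ` for its height `k'`, and the error of the other one is halved. -/
theorem abs_complete_sub_le {x : ℝ} (h0 : 0 ≤ x) (h1 : x ≤ 1) {n i k : ℕ}
    (hn : (i + 1) * 2 ^ k ≤ n) (hn' : n < (i + 1) * 2 ^ (k + 1)) :
    |1 - cutGF n x 1 i - phi x| ≤ 12 / (k + 1) := by
  induction k using Nat.strong_induction_on generalizing i with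
  | _ k ih =>
    rcases k with _ | _ | k
    · exact (abs_cutGF_sub_le_one h0 h1 n i).trans (by norm_num)
    · exact (abs_cutGF_sub_le_one h0 h1 n i).trans (by norm_num)
    · have hp := Nat.one_le_two_pow (n := k)
      have hk : (0 : ℝ) ≤ k := k.cast_nonneg
      have e1 : 2 ^ (k + 1 + 1) = 4 * 2 ^ k := by ring
      have e2 : 2 ^ (k + 1 + 1 + 1) = 8 * 2 ^ k := by ring
      have e3 : 2 ^ (k + 1) = 2 * 2 ^ k := by ring
      rw [e1] at hn
      rw [e2] at hn'
      have hlt : 2 * i + 1 < n := by nlinarith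
      rw [cutGF_of_lt x 1 (by omega), if_pos hlt]
      have hfin : (1 : ℝ) / 2 * (12 / (((k + 1 : ℕ) : ℝ) + 1)) + 2 / (k + 2) ≤
          12 / (((k + 1 + 1 : ℕ) : ℝ) + 1) := by
        push_cast
        rw [← sub_nonneg]
        have : (12 : ℝ) / (k + 1 + 1 + 1) - (1 / 2 * (12 / (k + 1 + 1)) + 2 / (k + 2)) =
            4 * k / ((k + 3) * (k + 2)) := by
          have h1 : (k : ℝ) + 1 + 1 + 1 ≠ 0 := by positivity
          have h2 : (k : ℝ) + 1 + 1 ≠ 0 := by positivity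
          have h3 : (k : ℝ) + 3 ≠ 0 := by positivity
          field_simp
          ring
        rw [this]
        positivity
      rcases le_or_gt ((2 * i + 3) * 2 ^ (k + 1)) n with h | h
      · -- the left subtree is full of height `k + 1`, the right one has height `k + 1`
        have hu : |1 - cutGF n x 1 (2 * i + 1) - phi x| ≤ 2 / (k + 2) := by
          refine (abs_perfect_sub_le h0 h1 (k := k + 1) (h.trans_lt (by omega))
            (by rw [e1]; nlinarith)).trans ?_
          push_cast
          gcongr
          linarith
        have ha := ih (k + 1) (by omega) (i := 2 * i + 2) h (by rw [e1]; nlinarith)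
        obtain ⟨c0, c1⟩ := cutGF_bounds h0 h1 n (2 * i + 2)
        exact (abs_step_le h0 h1 c0 c1 hu).trans ((by linarith : _ ≤ _).trans hfin)
      · -- the right subtree is full of height `k`, the left one has height `k + 1`
        have hu : |1 - cutGF n x 1 (2 * i + 2) - phi x| ≤ 2 / (k + 2) :=
          abs_perfect_sub_le h0 h1 (by nlinarith) (by omega)
        have ha := ih (k + 1) (by omega) (i := 2 * i + 1) (by rw [e3]; nlinarith)
          (by rw [e1]; nlinarith)
        obtain ⟨c0, c1⟩ := cutGF_bounds h0 h1 n (2 * i + 1)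
        rw [mul_comm (cutGF n x 1 (2 * i + 1))]
        exact (abs_step_le h0 h1 c0 c1 hu).trans ((by linarith : _ ≤ _).trans hfin)

/-- As `abs_complete_sub_le`, for a subtree of height at least `k`. -/
theorem abs_cutGF_sub_le {x : ℝ} (h0 : 0 ≤ x) (h1 : x ≤ 1) {n i k : ℕ}
    (hn : (i + 1) * 2 ^ k ≤ n) : |1 - cutGF n x 1 i - phi x| ≤ 12 / (k + 1) := by
  have hk : 2 ^ k ≤ n / (i + 1) := (Nat.le_div_iff_mul_le (by omega)).2 (by rwa [mul_comm])
  have hne : n / (i + 1) ≠ 0 := by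
    have := Nat.one_le_two_pow (n := k)
    omega
  have hlog : k ≤ Nat.log 2 (n / (i + 1)) := Nat.le_log_of_pow_le one_lt_two hk
  refine (abs_complete_sub_le h0 h1 (k := Nat.log 2 (n / (i + 1))) ?_ ?_).trans ?_
  · rw [mul_comm]
    exact (Nat.le_div_iff_mul_le (by omega)).1 (Nat.pow_log_le_self 2 hne)
  · rw [mul_comm]
    exact (Nat.div_lt_iff_lt_mul (by omega)).1 (Nat.lt_pow_succ_log_self one_lt_two _)
  · gcongr

theorem tendsto_cutGF {x : ℝ} (h0 : 0 ≤ x) (h1 : x ≤ 1) (i : ℕ) :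
    Tendsto (fun n => 1 - cutGF n x 1 i) atTop (𝓝 (phi x)) := by
  rw [Metric.tendsto_atTop]
  intro ε hε
  obtain ⟨k, hk⟩ := exists_nat_gt (12 / ε)
  refine ⟨(i + 1) * 2 ^ k, fun n hn => ?_⟩
  rw [Real.dist_eq]
  refine (abs_cutGF_sub_le h0 h1 hn).trans_lt ?_
  rw [div_lt_iff₀ hε] at hk
  rw [div_lt_iff₀ (by positivity)]
  nlinarith

theorem tendstoUniformlyOn_treePoly :
    TendstoUniformlyOn (fun (n : ℕ) (x : ℝ) => aeval x (treePoly (completeBinaryTree (n + 1)) 0))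
      phi atTop (Set.Icc (0 : ℝ) 1) := by
  rw [Metric.tendstoUniformlyOn_iff]
  intro ε hε
  obtain ⟨k, hk⟩ := exists_nat_gt (12 / ε)
  filter_upwards [eventually_ge_atTop (2 ^ k)] with n hn x hx
  rw [dist_comm, Real.dist_eq, treePoly,
    (heapLabelling_completeBinaryTree n).aeval_vertexPoly, (heapLabelling_completeBinaryTree n).root]
  refine (abs_cutGF_sub_le hx.1 hx.2 (k := k) (by omega)).trans_lt ?_
  rw [div_lt_iff₀ hε] at hk
  rw [div_lt_iff₀ (by positivity)]
  nlinarith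

end Limit

/-! ### Convergence of the masses -/

section Coefficients

/-- Symmetrization of the sum, together with `(a + 1) * catalan a = centralBinom a`, reduces this to
the recursion of the Catalan numbers. -/
theorem centralBinom_succ_eq_sum (m : ℕ) :
    (m + 1).centralBinom =
      2 * ∑ p ∈ Finset.HasAntidiagonal.antidiagonal m, p.1.centralBinom * catalan p.2 := by
  have h1 : ∑ p ∈ Finset.HasAntidiagonal.antidiagonal m, p.1.centralBinom * catalan p.2 =
      ∑ p ∈ Finset.HasAntidiagonal.antidiagonal m, (p.1 + 1) * (catalan p.1 * catalan p.2) :=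
    Finset.sum_congr rfl fun p _ => by rw [← succ_mul_catalan_eq_centralBinom, mul_assoc]
  have h2 : ∑ p ∈ Finset.HasAntidiagonal.antidiagonal m, p.1.centralBinom * catalan p.2 =
      ∑ p ∈ Finset.HasAntidiagonal.antidiagonal m, (p.2 + 1) * (catalan p.1 * catalan p.2) := by
    rw [h1, ← Finset.Nat.sum_antidiagonal_swap]
    exact Finset.sum_congr rfl fun p _ => by
      rw [Prod.fst_swap, Prod.snd_swap, mul_comm (catalan p.2)]
  rw [two_mul]
  nth_rw 1 [h1]
  rw [h2, ← Finset.sum_add_distrib, ← succ_mul_catalan_eq_centralBinom, catalan_succ',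
    Finset.mul_sum]
  refine Finset.sum_congr rfl fun p hp => ?_
  rw [← Finset.HasAntidiagonal.mem_antidiagonal.1 hp]
  ring

variable {n : ℕ}

theorem coeff_zero_cutGF (x : ℝ) {i : ℕ} (hi : i < n) :
    (cutGF n (C x) X i).coeff 0 = 1 - x := by
  rw [cutGF_of_lt _ _ hi, coeff_add, coeff_sub, coeff_one_zero, coeff_C_zero]
  split_ifs
  · rw [mul_assoc, coeff_C_mul, coeff_X_mul_zero, mul_zero, add_zero]
  · simp

theorem coeff_succ_cutGF (x : ℝ) {i : ℕ} (hi : 2 * i + 1 < n) (m : ℕ) :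
    (cutGF n (C x) X i).coeff (m + 1) = x * ∑ p ∈ Finset.HasAntidiagonal.antidiagonal m,
      (cutGF n (C x) X (2 * i + 1)).coeff p.1 * (cutGF n (C x) X (2 * i + 2)).coeff p.2 := by
  rw [cutGF_of_lt _ _ (by omega), if_pos hi, mul_assoc, coeff_add, coeff_C_mul,
    coeff_X_mul, coeff_mul, coeff_sub, ← C_1, coeff_C_succ, coeff_C_succ]
  ring

theorem coeff_zero_pivotGF (x : ℝ) {i : ℕ} (hi : i < n) :
    (pivotGF n (C x) X i).coeff 0 = 1 - cutGF n x 1 i := by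
  rw [pivotGF_of_lt _ _ hi, ← C_1, ← map_cutGF C x 1 i, mul_assoc, coeff_add, coeff_sub,
    coeff_C_zero, coeff_C_zero, coeff_C_mul, coeff_X_mul_zero, mul_zero, add_zero]

theorem coeff_succ_pivotGF (x : ℝ) {i : ℕ} (hi : i < n) (m : ℕ) :
    (pivotGF n (C x) X i).coeff (m + 1) = x *
      (∑ p ∈ Finset.HasAntidiagonal.antidiagonal m, (pivotGF n (C x) X (2 * i + 1)).coeff p.1 *
        (cutGF n (C x) X (2 * i + 2)).coeff p.2 +
      ∑ p ∈ Finset.HasAntidiagonal.antidiagonal m, (pivotGF n (C x) X (2 * i + 2)).coeff p.1 *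
        (cutGF n (C x) X (2 * i + 1)).coeff p.2) := by
  rw [pivotGF_of_lt _ _ hi, mul_assoc, mul_comm (cutGF n (C x) X (2 * i + 1)), coeff_add,
    coeff_C_mul, coeff_X_mul, coeff_add, coeff_mul, coeff_mul, ← C_1, ← map_cutGF C x 1 i,
    ← C_sub, coeff_C_succ, zero_add]

/-- In the limit, the component of the root is a given binary tree with `m` vertices with
probability `x ^ m * (1 - x) ^ (m + 1)`, and there are `catalan m` such trees. -/
theorem tendsto_coeff_cutGF (x : ℝ) (m i : ℕ) :
    Tendsto (fun n => (cutGF n (C x) X i).coeff m) atTop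
      (𝓝 (catalan m * (x ^ m * (1 - x) ^ (m + 1)))) := by
  induction m using Nat.strong_induction_on generalizing i with
  | _ m ih =>
    rcases m with _ | m
    · refine tendsto_const_nhds.congr' ?_
      filter_upwards [eventually_gt_atTop i] with n hn
      simp [coeff_zero_cutGF x hn]
    · have h : Tendsto (fun n => x * ∑ p ∈ Finset.HasAntidiagonal.antidiagonal m,
          (cutGF n (C x) X (2 * i + 1)).coeff p.1 * (cutGF n (C x) X (2 * i + 2)).coeff p.2) atTop
          (𝓝 (x * ∑ p ∈ Finset.HasAntidiagonal.antidiagonal m, catalan p.1 * (x ^ p.1 * (1 - x) ^ (p.1 + 1)) *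
            (catalan p.2 * (x ^ p.2 * (1 - x) ^ (p.2 + 1))))) := by
        refine (tendsto_finsetSum _ fun p hp => ?_).const_mul x
        have := Finset.HasAntidiagonal.mem_antidiagonal.1 hp
        exact (ih p.1 (by omega) _).mul (ih p.2 (by omega) _)
      have e : x * ∑ p ∈ Finset.HasAntidiagonal.antidiagonal m, (catalan p.1 : ℝ) * (x ^ p.1 * (1 - x) ^ (p.1 + 1)) *
          (catalan p.2 * (x ^ p.2 * (1 - x) ^ (p.2 + 1))) =
          catalan (m + 1) * (x ^ (m + 1) * (1 - x) ^ (m + 1 + 1)) := by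
        rw [catalan_succ', Nat.cast_sum, Finset.mul_sum, Finset.sum_mul]
        refine Finset.sum_congr rfl fun p hp => ?_
        rw [← Finset.HasAntidiagonal.mem_antidiagonal.1 hp]
        push_cast
        ring
      rw [← e]
      refine h.congr' ?_
      filter_upwards [eventually_gt_atTop (2 * i + 1)] with n hn
      rw [coeff_succ_cutGF x hn]

/-- The limit is the solution of the recursion `coeff_succ_pivotGF` that starts at `φ(x)`. -/
theorem tendsto_coeff_pivotGF {x : ℝ} (h0 : 0 ≤ x) (h1 : x ≤ 1) (m i : ℕ) :
    Tendsto (fun n => (pivotGF n (C x) X i).coeff m) atTop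
      (𝓝 (m.centralBinom * (x * (1 - x)) ^ m * phi x)) := by
  induction m using Nat.strong_induction_on generalizing i with
  | _ m ih =>
    rcases m with _ | m
    · simp only [Nat.centralBinom_zero, Nat.cast_one, pow_zero, one_mul]
      refine (tendsto_cutGF h0 h1 i).congr' ?_
      filter_upwards [eventually_gt_atTop i] with n hn
      rw [coeff_zero_pivotGF x hn]
    · have h : ∀ i j, Tendsto (fun n => ∑ p ∈ Finset.HasAntidiagonal.antidiagonal m,
          (pivotGF n (C x) X i).coeff p.1 * (cutGF n (C x) X j).coeff p.2) atTop
          (𝓝 (∑ p ∈ Finset.HasAntidiagonal.antidiagonal m, p.1.centralBinom * (x * (1 - x)) ^ p.1 * phi x *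
            (catalan p.2 * (x ^ p.2 * (1 - x) ^ (p.2 + 1))))) := by
        intro i j
        refine tendsto_finsetSum _ fun p hp => ?_
        have := Finset.HasAntidiagonal.mem_antidiagonal.1 hp
        exact (ih p.1 (by omega) _).mul (tendsto_coeff_cutGF x _ _)
      have e : x * (∑ p ∈ Finset.HasAntidiagonal.antidiagonal m, (p.1.centralBinom : ℝ) * (x * (1 - x)) ^ p.1 *
          phi x * (catalan p.2 * (x ^ p.2 * (1 - x) ^ (p.2 + 1))) +
          ∑ p ∈ Finset.HasAntidiagonal.antidiagonal m, (p.1.centralBinom : ℝ) * (x * (1 - x)) ^ p.1 *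
          phi x * (catalan p.2 * (x ^ p.2 * (1 - x) ^ (p.2 + 1)))) =
          (m + 1).centralBinom * (x * (1 - x)) ^ (m + 1) * phi x := by
        rw [centralBinom_succ_eq_sum, ← two_mul, Nat.cast_mul, Nat.cast_sum, Finset.mul_sum,
          Finset.mul_sum, Finset.mul_sum, Finset.sum_mul, Finset.sum_mul]
        refine Finset.sum_congr rfl fun p hp => ?_
        rw [← Finset.HasAntidiagonal.mem_antidiagonal.1 hp]
        push_cast
        simp only [mul_pow]
        ring
      rw [← e]
      refine (((h (2 * i + 1) (2 * i + 2)).add (h (2 * i + 2) (2 * i + 1))).const_mul x).congr' ?_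
      filter_upwards [eventually_gt_atTop i] with n hn
      rw [coeff_succ_pivotGF x hn]

theorem abs_coeff_cutGF_le {x : ℝ} (h0 : 0 ≤ x) (h1 : x ≤ 1) (n m i : ℕ) :
    |(cutGF n (C x) X i).coeff m| ≤ catalan m := by
  induction m using Nat.strong_induction_on generalizing i with
  | _ m ih =>
    rcases le_or_gt n i with hi | hi
    · rw [cutGF_of_le _ _ hi, coeff_one]
      split_ifs with h
      · simp [h]
      · simp
    · rcases m with _ | m
      · rw [coeff_zero_cutGF x hi, catalan_zero, Nat.cast_one, abs_le]
        constructor <;> linarith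
      · by_cases hi' : 2 * i + 1 < n
        · rw [coeff_succ_cutGF x hi', abs_mul, abs_of_nonneg h0, catalan_succ', Nat.cast_sum]
          refine (mul_le_of_le_one_left (abs_nonneg _) h1).trans
            ((Finset.abs_sum_le_sum_abs _ _).trans (Finset.sum_le_sum fun p hp => ?_))
          have := Finset.HasAntidiagonal.mem_antidiagonal.1 hp
          rw [abs_mul, Nat.cast_mul]
          exact mul_le_mul (ih _ (by omega) _) (ih _ (by omega) _) (abs_nonneg _)
            (Nat.cast_nonneg _)
        · rw [cutGF_of_lt _ _ hi, if_neg hi', add_zero, coeff_sub, ← C_1, coeff_C_succ,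
            coeff_C_succ, sub_self, abs_zero]
          exact Nat.cast_nonneg _

/-- The factor `x` makes up for the singular factor `x⁻¹` in the law of the size of the separation
graph. -/
theorem abs_coeff_pivotGF_le {x : ℝ} (h0 : 0 ≤ x) (h1 : x ≤ 1) (n m i : ℕ) :
    |(pivotGF n (C x) X i).coeff m| ≤ m.centralBinom * x := by
  induction m using Nat.strong_induction_on generalizing i with
  | _ m ih =>
    rcases le_or_gt n i with hi | hi
    · rw [pivotGF_of_le _ _ hi, coeff_zero, abs_zero]
      positivity
    · rcases m with _ | m
      · rw [coeff_zero_pivotGF x hi, Nat.centralBinom_zero, Nat.cast_one, one_mul]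
        obtain ⟨c0, c1⟩ := cutGF_bounds h0 h1 n i
        rw [abs_of_nonneg (by linarith), cutGF_of_lt x 1 hi]
        obtain ⟨a0, -⟩ := cutGF_bounds h0 h1 n (2 * i + 1)
        obtain ⟨b0, -⟩ := cutGF_bounds h0 h1 n (2 * i + 2)
        have : 0 ≤ x * 1 * (cutGF n x 1 (2 * i + 1) * cutGF n x 1 (2 * i + 2)) := by positivity
        split_ifs <;> linarith
      · have key : ∀ i j, |∑ p ∈ Finset.HasAntidiagonal.antidiagonal m, (pivotGF n (C x) X i).coeff p.1 *
            (cutGF n (C x) X j).coeff p.2| ≤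
            (∑ p ∈ Finset.HasAntidiagonal.antidiagonal m, (p.1.centralBinom : ℝ) * catalan p.2) * x := by
          intro i j
          rw [Finset.sum_mul]
          refine (Finset.abs_sum_le_sum_abs _ _).trans (Finset.sum_le_sum fun p hp => ?_)
          have := Finset.HasAntidiagonal.mem_antidiagonal.1 hp
          rw [abs_mul, mul_right_comm]
          exact mul_le_mul (ih _ (by omega) _) (abs_coeff_cutGF_le h0 h1 n _ _) (abs_nonneg _)
            (by positivity)
        rw [coeff_succ_pivotGF x hi, abs_mul, abs_of_nonneg h0, centralBinom_succ_eq_sum]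
        refine (mul_le_of_le_one_left (abs_nonneg _) h1).trans ((abs_add_le _ _).trans
          ((add_le_add (key _ _) (key _ _)).trans_eq ?_))
        push_cast
        ring

theorem continuous_coeff_pivotGF (n m i : ℕ) :
    Continuous fun x : ℝ => (pivotGF n (C x) X i).coeff m := by
  have : ∀ x : ℝ, (pivotGF n (C x) X i).coeff m = ∑ W ∈ (heapSub n i).powerset,
      x ^ W.card * (1 - x) ^ ((heapSub n i).card - W.card) *
        (pivotWeight n (X : ℝ[X]) i W).coeff m := by
    intro x
    rw [pivotGF, subsetSum, finsetSum_coeff]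
    refine Finset.sum_congr rfl fun W _ => ?_
    rw [← C_1, ← C_sub, ← C_pow, ← C_pow, ← C_mul, coeff_C_mul]
  simp only [this]
  fun_prop

end Coefficients

/-! ### The limit law -/

section LimitLaw

/-- A continuous function which agrees with `φ(x) / x` for `x > 0`. -/
def phiDiv (x : ℝ) : ℝ := (2 - (max x (1 / 2))⁻¹) * (max x (1 / 2))⁻¹

theorem continuous_phiDiv : Continuous phiDiv := by
  have h : ∀ x : ℝ, max x (1 / 2) ≠ 0 := fun x => by
    have := le_max_right x (1 / 2)
    intro h
    linarith
  unfold phiDiv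
  fun_prop (disch := exact h _)

theorem phiDiv_of_le_half {x : ℝ} (h : x ≤ 1 / 2) : phiDiv x = 0 := by
  rw [phiDiv, max_eq_right h]
  norm_num

theorem phiDiv_of_half_le {x : ℝ} (h : 1 / 2 ≤ x) : phiDiv x = (2 * x - 1) * (x ^ 2)⁻¹ := by
  have : x ≠ 0 := by linarith
  rw [phiDiv, max_eq_left h]
  field_simp

theorem phiDiv_nonneg (x : ℝ) : 0 ≤ phiDiv x := by
  rcases le_total x (1 / 2) with h | h
  · rw [phiDiv_of_le_half h]
  · rw [phiDiv_of_half_le h]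
    have : 0 ≤ 2 * x - 1 := by linarith
    positivity

theorem inv_mul_phi {x : ℝ} (h : 0 < x) : x⁻¹ * phi x = phiDiv x := by
  rcases le_total x (1 / 2) with h' | h'
  · rw [phiDiv_of_le_half h', phi_of_le_half h.le h', mul_zero]
  · rw [phiDiv_of_half_le h', phi_of_half_le h']
    field_simp

theorem limitMass_eq (m : ℕ) :
    limitMass m = ∫ x in (0 : ℝ)..1, m.centralBinom * (x * (1 - x)) ^ m * phiDiv x := by
  rw [limitMass, ← Nat.centralBinom_eq_two_mul_choose, ← intervalIntegral.integral_const_mul]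
  refine intervalIntegral.integral_congr_ae (.of_forall fun x hx => ?_)
  rw [Set.uIoc_of_le zero_le_one] at hx
  rw [← inv_mul_phi hx.1, zpow_sub_one₀ hx.1.ne', zpow_natCast, mul_pow]
  ring

theorem tendsto_integral_coeff_pivotGF (m : ℕ) :
    Tendsto (fun n => ∫ x in (0 : ℝ)..1, x⁻¹ * (pivotGF n (C x) X 0).coeff m) atTop
      (𝓝 (limitMass m)) := by
  rw [limitMass_eq]
  refine intervalIntegral.tendsto_integral_filter_of_dominated_convergence
    (fun _ => (m.centralBinom : ℝ)) (.of_forall fun n => ?_) (.of_forall fun n => ?_)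
    intervalIntegrable_const (.of_forall fun x hx => ?_)
  · exact (measurable_inv.mul (continuous_coeff_pivotGF n m 0).measurable).aestronglyMeasurable
  · refine .of_forall fun x hx => ?_
    rw [Set.uIoc_of_le zero_le_one] at hx
    rw [Real.norm_eq_abs, abs_mul, abs_of_pos (inv_pos.2 hx.1), inv_mul_le_iff₀ hx.1, mul_comm x]
    exact abs_coeff_pivotGF_le hx.1.le hx.2 n m 0
  · rw [Set.uIoc_of_le zero_le_one] at hx
    have := (tendsto_coeff_pivotGF hx.1.le hx.2 m 0).const_mul x⁻¹
    rwa [mul_left_comm, inv_mul_phi hx.1] at this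

theorem limitMass_nonneg (m : ℕ) : 0 ≤ limitMass m := by
  rw [limitMass_eq]
  refine intervalIntegral.integral_nonneg zero_le_one fun x hx => ?_
  have := phiDiv_nonneg x
  have := mul_nonneg hx.1 (sub_nonneg.2 hx.2)
  positivity

theorem centralBinom_le_four_pow (m : ℕ) : m.centralBinom ≤ 4 ^ m := by
  rw [Nat.centralBinom_eq_two_mul_choose, show 4 = 2 ^ 2 by rfl, ← pow_mul]
  exact Nat.choose_le_two_pow _ _

theorem catalan_le_centralBinom (m : ℕ) : catalan m ≤ m.centralBinom := by
  rw [← succ_mul_catalan_eq_centralBinom]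
  exact Nat.le_mul_of_pos_left _ (Nat.succ_pos m)

/-- The generating function `1 / √(1 - 4 y)` of the central binomial coefficients, at
`y = x (1 - x)`. -/
theorem hasSum_centralBinom {x : ℝ} (h : 1 / 2 < x) (h1 : x ≤ 1) :
    HasSum (fun m : ℕ => (m.centralBinom : ℝ) * (x * (1 - x)) ^ m) (2 * x - 1)⁻¹ := by
  set y := x * (1 - x) with hy
  have hy0 : 0 ≤ y := mul_nonneg (by linarith) (by linarith)
  have hy1 : 4 * y < 1 := by nlinarith [mul_pos (sub_pos.2 h) (sub_pos.2 h)]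
  have hf : Summable fun m : ℕ => (m.centralBinom : ℝ) * y ^ m := by
    refine Summable.of_nonneg_of_le (fun m => by positivity) (fun m => ?_)
      (summable_geometric_of_lt_one (by linarith : 0 ≤ 4 * y) hy1)
    rw [mul_pow 4]
    have : (m.centralBinom : ℝ) ≤ 4 ^ m := by exact_mod_cast centralBinom_le_four_pow m
    exact mul_le_mul_of_nonneg_right this (pow_nonneg hy0 m)
  have hc : Summable fun m : ℕ => (catalan m : ℝ) * y ^ m := by
    refine Summable.of_nonneg_of_le (fun m => by positivity) (fun m => ?_) hf
    exact mul_le_mul_of_nonneg_right (by exact_mod_cast catalan_le_centralBinom m)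
      (pow_nonneg hy0 m)
  set f := ∑' m : ℕ, (m.centralBinom : ℝ) * y ^ m with hf'
  set c := ∑' m : ℕ, (catalan m : ℝ) * y ^ m with hc'
  have e1 : f = 1 + 2 * y * (f * c) := by
    conv_lhs => rw [hf', hf.tsum_eq_zero_add]
    rw [hf', hc', tsum_mul_tsum_eq_tsum_sum_antidiagonal_of_summable_norm hf.norm hc.norm, ← tsum_mul_left]
    congr 1
    · simp
    · refine tsum_congr fun m => ?_
      rw [centralBinom_succ_eq_sum, Nat.cast_mul, Nat.cast_sum, Finset.mul_sum, Finset.mul_sum,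
        Finset.sum_mul]
      refine Finset.sum_congr rfl fun p hp => ?_
      rw [← Finset.HasAntidiagonal.mem_antidiagonal.1 hp]
      push_cast
      ring
  have e2 : c = 1 + y * (c * c) := by
    conv_lhs => rw [hc', hc.tsum_eq_zero_add]
    rw [hc', tsum_mul_tsum_eq_tsum_sum_antidiagonal_of_summable_norm hc.norm hc.norm, ← tsum_mul_left]
    congr 1
    · simp
    · refine tsum_congr fun m => ?_
      rw [catalan_succ', Nat.cast_sum, Finset.mul_sum, Finset.sum_mul]
      refine Finset.sum_congr rfl fun p hp => ?_
      rw [← Finset.HasAntidiagonal.mem_antidiagonal.1 hp]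
      push_cast
      ring
  have hf0 : 0 ≤ f := tsum_nonneg fun m => by positivity
  -- `f (1 - 2 y c) = 1` and `(1 - 2 y c) ^ 2 = 1 - 4 y = (2 x - 1) ^ 2`
  have e3 : (f * (2 * x - 1)) ^ 2 = 1 := by
    have e4 : f * (1 - 2 * y * c) = 1 := by linear_combination e1
    have e5 : (2 * x - 1) ^ 2 = (1 - 2 * y * c) ^ 2 := by
      linear_combination 4 * y * e2 - 4 * hy
    rw [mul_pow, e5, ← mul_pow, e4, one_pow]
  have e6 : f * (2 * x - 1) = 1 :=
    (pow_eq_one_iff_of_nonneg (mul_nonneg hf0 (by linarith)) two_ne_zero).1 e3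
  rw [← eq_inv_of_mul_eq_one_left e6]
  exact hf.hasSum

theorem hasSum_limitMass : HasSum limitMass 1 := by
  -- the sum of the integrands is `1 / x ^ 2` on `(1 / 2, 1]` and zero on `(0, 1 / 2]`
  set g : ℝ → ℝ := Set.indicator (Set.Ioc (1 / 2) 1) fun x => (x ^ 2)⁻¹ with hg
  have hsum : ∀ x ∈ Set.uIoc (0 : ℝ) 1,
      HasSum (fun m : ℕ => (m.centralBinom : ℝ) * (x * (1 - x)) ^ m * phiDiv x) (g x) := by
    intro x hx
    rw [Set.uIoc_of_le zero_le_one] at hx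
    rcases le_or_gt x (1 / 2) with h | h
    · rw [hg, Set.indicator_of_notMem (fun hh => absurd hh.1 (not_lt.2 h)), phiDiv_of_le_half h]
      simp only [mul_zero, hasSum_zero]
    · rw [hg, Set.indicator_of_mem (Set.mem_Ioc.2 ⟨h, hx.2⟩), phiDiv_of_half_le h.le]
      have := (hasSum_centralBinom h hx.2).mul_right ((2 * x - 1) * (x ^ 2)⁻¹)
      rwa [inv_mul_cancel_left₀ (by linarith : 2 * x - 1 ≠ 0)] at this
  have hpos : ∀ x ∈ Set.uIcc (1 / 2 : ℝ) 1, x ≠ 0 := by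
    intro x hx
    rw [Set.uIcc_of_le (by norm_num)] at hx
    linarith [hx.1]
  have hcont : IntervalIntegrable (fun x : ℝ => (x ^ 2)⁻¹) volume (1 / 2) 1 :=
    ContinuousOn.intervalIntegrable (by
      refine ContinuousOn.inv₀ (by fun_prop) fun x hx => pow_ne_zero 2 (hpos x hx))
  have hgi : IntegrableOn g (Set.Ioc 0 1) := by
    rw [intervalIntegrable_iff_integrableOn_Ioc_of_le (by norm_num)] at hcont
    exact ((integrable_indicator_iff measurableSet_Ioc).2 hcont).integrableOn
  have hint : ∫ x in (0 : ℝ)..1, g x = 1 := by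
    rw [intervalIntegral.integral_of_le zero_le_one, hg,
      setIntegral_indicator measurableSet_Ioc,
      Set.inter_eq_self_of_subset_right (Set.Ioc_subset_Ioc_left (by norm_num)),
      ← intervalIntegral.integral_of_le (by norm_num),
      intervalIntegral.integral_eq_sub_of_hasDerivAt (f := fun x => -x⁻¹) _ hcont]
    · norm_num
    · intro x hx
      exact (hasDerivAt_inv (hpos x hx)).neg.congr_deriv (neg_neg _)
  have hlim := intervalIntegral.hasSum_integral_of_dominated_convergence (μ := volume)
    (a := (0 : ℝ)) (b := 1) (f := g)
    (F := fun (m : ℕ) x => (m.centralBinom : ℝ) * (x * (1 - x)) ^ m * phiDiv x)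
    (fun (m : ℕ) x => (m.centralBinom : ℝ) * (x * (1 - x)) ^ m * phiDiv x)
    (fun m => Continuous.aestronglyMeasurable (by have := continuous_phiDiv; fun_prop))
    (fun m => .of_forall fun x hx => ?_) (.of_forall fun x hx => (hsum x hx).summable) ?_
    (.of_forall hsum)
  · simpa only [← limitMass_eq, hint] using hlim
  · rw [Set.uIoc_of_le zero_le_one] at hx
    have := phiDiv_nonneg x
    have := mul_nonneg hx.1.le (sub_nonneg.2 hx.2)
    rw [Real.norm_of_nonneg (by positivity)]
  · rw [intervalIntegrable_iff_integrableOn_Ioc_of_le zero_le_one]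
    refine hgi.congr_fun (fun x hx => ?_) measurableSet_Ioc
    rw [← Set.uIoc_of_le zero_le_one] at hx
    exact (hsum x hx).tsum_eq.symm

/-- The integral of `(x * (1 - x)) ^ (m + 1) * (2 * x - 1)` over `[1 / 2, 1]` is a lower bound of the
integral in the mass, because `φ(x) / x = (2 * x - 1) / x ^ 2` there. -/
theorem le_mul_limitMass (m : ℕ) :
    1 / 8 * (1 / ((m : ℝ) + 1 + 1)) ≤ ((m + 1 : ℕ) : ℝ) * limitMass (m + 1) := by
  have hd : ∀ x ∈ Set.uIcc (1 / 2 : ℝ) 1, HasDerivAt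
      (fun x : ℝ => -((x * (1 - x)) ^ (m + 1 + 1) / ((m : ℝ) + 1 + 1)))
      ((x * (1 - x)) ^ (m + 1) * (2 * x - 1)) x := by
    intro x _
    have h1 : HasDerivAt (fun x : ℝ => x * (1 - x)) (1 * (1 - x) + x * (0 - 1)) x :=
      (hasDerivAt_id x).mul ((hasDerivAt_const x 1).sub (hasDerivAt_id x))
    refine ((h1.pow (m + 1 + 1)).div_const _).neg.congr_deriv ?_
    have : (m : ℝ) + 1 + 1 ≠ 0 := by positivity
    push_cast
    field_simp
    ring
  have hF := intervalIntegral.integral_eq_sub_of_hasDerivAt hd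
    (Continuous.intervalIntegrable (by fun_prop) _ _)
  have hcont : ∀ a b : ℝ, IntervalIntegrable
      (fun x => (x * (1 - x)) ^ (m + 1) * phiDiv x) volume a b := fun a b =>
    Continuous.intervalIntegrable (by have := continuous_phiDiv; fun_prop) _ _
  have hle : ∫ x in (1 / 2 : ℝ)..1, (x * (1 - x)) ^ (m + 1) * (2 * x - 1) ≤
      ∫ x in (0 : ℝ)..1, (x * (1 - x)) ^ (m + 1) * phiDiv x := by
    rw [← intervalIntegral.integral_add_adjacent_intervals (hcont 0 (1 / 2)) (hcont (1 / 2) 1)]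
    refine le_add_of_nonneg_of_le (intervalIntegral.integral_nonneg (by norm_num) fun x hx => ?_)
      (intervalIntegral.integral_mono_on (by norm_num)
        (Continuous.intervalIntegrable (by fun_prop) _ _) (hcont _ _) fun x hx => ?_)
    · have := phiDiv_nonneg x
      have := mul_nonneg hx.1 (by linarith [hx.2] : 0 ≤ 1 - x)
      positivity
    · have hx0 : 0 < x := by linarith [hx.1]
      rw [phiDiv_of_half_le hx.1]
      refine mul_le_mul_of_nonneg_left ?_
        (pow_nonneg (mul_nonneg hx0.le (sub_nonneg.2 hx.2)) _)
      exact le_mul_of_one_le_right (by linarith [hx.1])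
        ((one_le_inv₀ (by positivity)).2 (pow_le_one₀ hx0.le hx.2))
  have hb : (4 : ℝ) ^ (m + 1) ≤ 2 * ((m + 1 : ℕ) : ℝ) * (m + 1).centralBinom := by
    exact_mod_cast Nat.four_pow_le_two_mul_self_mul_centralBinom (m + 1) (Nat.succ_pos m)
  have hmass : limitMass (m + 1) = (m + 1).centralBinom *
      ∫ x in (0 : ℝ)..1, (x * (1 - x)) ^ (m + 1) * phiDiv x := by
    rw [limitMass_eq, ← intervalIntegral.integral_const_mul]
    simp only [mul_assoc]
  have hval : ∫ x in (1 / 2 : ℝ)..1, (x * (1 - x)) ^ (m + 1) * (2 * x - 1) =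
      (1 / 4) * (1 / 4 ^ (m + 1)) * (1 / ((m : ℝ) + 1 + 1)) := by
    rw [hF]
    have : (1 / 2 * (1 - 1 / 2) : ℝ) = 1 / 4 := by norm_num
    rw [this, sub_self, mul_zero, zero_pow (by omega), pow_succ, one_div_pow]
    ring
  rw [hval] at hle
  rw [hmass, ← mul_assoc]
  have h4 : (0 : ℝ) < 4 ^ (m + 1) := by positivity
  have hs : (0 : ℝ) ≤ 1 / ((m : ℝ) + 1 + 1) := by positivity
  calc 1 / 8 * (1 / ((m : ℝ) + 1 + 1)) =
      (4 ^ (m + 1) / 2) * (1 / 4 * (1 / 4 ^ (m + 1)) * (1 / ((m : ℝ) + 1 + 1))) := by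
        field_simp
        norm_num
    _ ≤ ((m + 1 : ℕ) : ℝ) * (m + 1).centralBinom *
        ∫ x in (0 : ℝ)..1, (x * (1 - x)) ^ (m + 1) * phiDiv x := by
        refine mul_le_mul (by linarith) hle (by positivity) (by positivity)

theorem not_summable_mul_limitMass : ¬ Summable fun m : ℕ => (m : ℝ) * limitMass m := by
  intro h
  have h1 := (summable_nat_add_iff 1).2 h
  have h2 : Summable fun m : ℕ => 1 / 8 * (1 / ((m : ℝ) + 1 + 1)) :=
    Summable.of_nonneg_of_le (fun m => by positivity) le_mul_limitMass h1
  rw [summable_mul_left_iff (by norm_num)] at h2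
  refine Real.not_summable_one_div_natCast ((summable_nat_add_iff 2).1 ?_)
  refine h2.congr fun m => ?_
  push_cast
  ring

/-- On `ℕ`, convergence of the masses to those of a probability measure implies weak convergence, by
Fatou's lemma for the counting measure. -/
theorem tendsto_of_forall_real_singleton {μs : ℕ → ProbabilityMeasure ℕ}
    {μ : ProbabilityMeasure ℕ} (h : ∀ m, Tendsto (fun n => (μs n : Measure ℕ).real {m}) atTop
      (𝓝 ((μ : Measure ℕ).real {m}))) : Tendsto μs atTop (𝓝 μ) := by
  refine tendsto_of_forall_isOpen_le_liminf' fun G _ => ?_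
  have hlim : ∀ m, Tendsto (fun n => G.indicator (fun m => (μs n : Measure ℕ) {m}) m) atTop
      (𝓝 (G.indicator (fun m => (μ : Measure ℕ) {m}) m)) := by
    intro m
    by_cases hm : m ∈ G
    · simp only [Set.indicator_of_mem hm]
      exact (ENNReal.tendsto_toReal_iff (fun _ => measure_ne_top _ _) (measure_ne_top _ _)).1 (h m)
    · simp only [Set.indicator_of_notMem hm, tendsto_const_nhds_iff]
  have hsum : ∀ ν : Measure ℕ, ν G = ∫⁻ m, G.indicator (fun m => ν {m}) m ∂Measure.count := by
    intro ν
    rw [lintegral_count, ν.tsum_indicator_apply_singleton G (MeasurableSet.of_discrete)]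
  simp only [hsum]
  rw [lintegral_congr fun m => (hlim m).liminf_eq.symm]
  exact lintegral_liminf_le fun n => Measurable.of_discrete

/-- The limit law, with the masses `limitMass`. -/
def limitLaw : PMF ℕ :=
  ⟨fun m => ENNReal.ofReal (limitMass m), by
    have := ENNReal.ofReal_tsum_of_nonneg limitMass_nonneg hasSum_limitMass.summable
    rw [hasSum_limitMass.tsum_eq, ENNReal.ofReal_one] at this
    rw [this]
    exact ENNReal.summable.hasSum⟩

theorem limitLaw_singleton (m : ℕ) : limitLaw.toMeasure {m} = ENNReal.ofReal (limitMass m) :=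
  PMF.toMeasure_apply_singleton _ _ (measurableSet_singleton m)

theorem lintegral_limitLaw : ∫⁻ m : ℕ, (m : ENNReal) ∂limitLaw.toMeasure = ⊤ := by
  by_contra h
  rw [lintegral_countable'] at h
  refine not_summable_mul_limitMass ((ENNReal.summable_toReal h).congr fun m => ?_)
  rw [ENNReal.toReal_mul, limitLaw_singleton, ENNReal.toReal_ofReal (limitMass_nonneg m),
    ENNReal.toReal_natCast]

end LimitLaw

end TreeCut

end

theorem proposition6p4 :
    TendstoUniformlyOn
      (fun (n : ℕ) (x : ℝ) =>
        Polynomial.aeval x (TreeCut.treePoly (TreeCut.completeBinaryTree (n + 1)) 0))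
      TreeCut.phi atTop (Set.Icc (0 : ℝ) 1) ∧
    ∃ μ : ProbabilityMeasure ℕ,
      (∀ m : ℕ, (μ : Measure ℕ).real {m} = TreeCut.limitMass m) ∧
      Tendsto
        (fun n : ℕ => TreeCut.treeSeparationSizeLaw (TreeCut.completeBinaryTree (n + 1)) 0)
        atTop (𝓝 μ) ∧
      Tendsto
        (fun n : ℕ =>
          TreeCut.treeSeparationSizeLaw (TreeCut.fullBinaryTree (n + 1)) (TreeCut.fullRoot n))
        atTop (𝓝 μ) ∧
      ∫⁻ m : ℕ, (m : ENNReal) ∂(μ : Measure ℕ) = ⊤ := by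
  have hmass : ∀ m, TreeCut.limitLaw.toMeasure.real {m} = TreeCut.limitMass m := fun m => by
    rw [Measure.real, TreeCut.limitLaw_singleton, ENNReal.toReal_ofReal (TreeCut.limitMass_nonneg m)]
  refine ⟨TreeCut.tendstoUniformlyOn_treePoly,
    ⟨TreeCut.limitLaw.toMeasure, inferInstance⟩, hmass,
    TreeCut.tendsto_of_forall_real_singleton fun m => ?_,
    TreeCut.tendsto_of_forall_real_singleton fun m => ?_, TreeCut.lintegral_limitLaw⟩
  · simp only [(TreeCut.heapLabelling_completeBinaryTree _).treeSeparationSizeLaw_real_singleton]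
    refine Eq.subst (motive := fun a => Tendsto _ atTop (𝓝 a)) (hmass m).symm ?_
    exact (TreeCut.tendsto_integral_coeff_pivotGF m).comp (tendsto_add_atTop_nat 1)
  · simp only [(TreeCut.heapLabelling_fullBinaryTree _).treeSeparationSizeLaw_real_singleton]
    refine Eq.subst (motive := fun a => Tendsto _ atTop (𝓝 a)) (hmass m).symm ?_
    have h : Tendsto (fun n : ℕ => 2 ^ (n + 1) - 1) atTop atTop :=
      tendsto_atTop_mono (fun n => Nat.le_sub_one_of_lt ((Nat.lt_succ_self n).trans
        Nat.lt_two_pow_self)) tendsto_id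
    exact (TreeCut.tendsto_integral_coeff_pivotGF m).comp h
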